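/- Consider a tournament with teams $t_1,\dots,t_n$, where $n$ is a positive multiple of $4$, in which team $t_i$ has scored $s_i\in\mathbb{N}_0$ points so far. In every round the teams are ranked by their current number of points, ties being broken in favour of the team with the smaller index (so $t_1$ always wins ties), and for each $r\ge 0$ the teams with ranks $4r+1,4r+2,4r+3,4r+4$ play a match, in which the four teams score $3,2,1,0$ points in some order. With $\ell$ rounds left and a threshold $b\in\mathbb{N}_0$, we say that $t_1$ can still break if there are outcomes of all remaining matches such that in the end at most $b-1$ teams have more points than $t_1$. There are an algorithm (a random access machine program whose only arithmetic operations are addition and truncated subtraction, each instruction counting as one step) and a constant $C$ such that, for all $k\ge 1$ and all inputs $(\ell,b,s_1,\dots,s_n)$ with $\ell\le k$, the algorithm decides within $n^{Ck^4}$ steps, i.e. in time $n^{O(k^4)}$, whether $t_1$ can still break with $\ell$ rounds left; the threshold $b$ is arbitrary and part of the input. Moreover, for every constant $k\ge 0$, the problem of deciding whether $t_1$ can still break, restricted to inputs with at most $k$ rounds left, is in $\mathsf{P}$: it is decided by a random access machine program in time polynomial in the bit length of the input, where every instruction is charged for the number of bits of the numbers and addresses it works on (logarithmic cost). -/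

import Mathlib

/-! ### Debating tournaments -/

namespace Debating

/-- Team `i` is ranked before team `j`: it has more points, or equally many points and a smaller
number. The numbering of the teams is the fixed total order that breaks ties; in particular the
first team (number `0` in Lean) is always preferred. -/
def Before {n : ℕ} (s : Fin n → ℕ) (i j : Fin n) : Prop :=
  s j < s i ∨ (s i = s j ∧ i < j)

instance {n : ℕ} (s : Fin n → ℕ) (i j : Fin n) : Decidable (Before s i j) :=
  inferInstanceAs (Decidable (_ ∨ _))

/-- The rank of team `i`, counted from `0`: the number of teams that are ranked before it. -/
def rank {n : ℕ} (s : Fin n → ℕ) (i : Fin n) : ℕ :=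
  (Finset.univ.filter fun j => Before s j i).card

/-- The match in which team `i` plays in the next round: match `r` is played by the teams whose
ranks, counted from `0`, are `4r`, `4r+1`, `4r+2`, `4r+3`. -/
def matchOf {n : ℕ} (s : Fin n → ℕ) (i : Fin n) : ℕ :=
  rank s i / 4

/-- `p` assigns to the teams the points of one round with pairings according to `s`: in every match
the four teams score `3`, `2`, `1` and `0` points, in some order (as the number of teams is a
multiple of four, every match has four teams, so it is enough that their points differ). -/
def IsOutcome {n : ℕ} (s : Fin n → ℕ) (p : Fin n → Fin 4) : Prop :=
  ∀ i j : Fin n, i ≠ j → matchOf s i = matchOf s j → p i ≠ p j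

/-- `CanBreak t b k s`: with `k` rounds left and current scores `s`, there are outcomes of all
remaining matches such that in the end at most `b - 1` teams have more points than `t`. -/
def CanBreak {n : ℕ} (t : Fin n) (b : ℕ) : ℕ → (Fin n → ℕ) → Prop
  | 0, s => (Finset.univ.filter fun j => s t < s j).card < b
  | k + 1, s => ∃ p : Fin n → Fin 4, IsOutcome s p ∧ CanBreak t b k fun i => s i + (p i : ℕ)

/-- An instance of the tournament problem. -/
structure Tournament where
  /-- the number of teams, a positive multiple of `4` -/
  teams : ℕ
  teams_pos : 0 < teams
  four_dvd_teams : 4 ∣ teams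
  /-- the points scored so far -/
  score : Fin teams → ℕ
  /-- the number of rounds that are left -/
  rounds : ℕ
  /-- the breaking threshold -/
  threshold : ℕ

namespace Tournament

/-- The distinguished team `t₁`. -/
def firstTeam (x : Tournament) : Fin x.teams := ⟨0, x.teams_pos⟩

/-- The question: can `t₁` still finish among the best `b` teams? -/
def IsYes (x : Tournament) : Prop :=
  CanBreak x.firstTeam x.threshold x.rounds x.score

/-- An instance as an input for a machine: `k, b, s₁, …, sₙ`. -/
def encode (x : Tournament) : List ℕ :=
  x.rounds :: x.threshold :: List.ofFn x.score

end Tournament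

end Debating

/-! ### Random access machines

A machine has registers and a memory, both indexed by natural numbers and holding natural numbers.
A program names finitely many registers; the memory is accessed by indirect addressing.
The only arithmetic operations are addition and subtraction. -/

namespace RAM

/-- The contents of the registers and of the memory. -/
@[ext]
structure State where
  reg : ℕ → ℕ
  mem : ℕ → ℕ

/-- The elementary instructions. -/
inductive Op where
  /-- `R d := c` -/
  | const (d c : ℕ)
  /-- `R d := R a + R b` -/
  | add (d a b : ℕ)
  /-- `R d := max (R a - R b) 0` -/
  | sub (d a b : ℕ)
  /-- `R d := M (R a)` -/
  | load (d a : ℕ)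
  /-- `M (R a) := R b` -/
  | store (a b : ℕ)

/-- The effect of an elementary instruction. -/
def Op.run : Op → State → State
  | .const d c, σ => { σ with reg := Function.update σ.reg d c }
  | .add d a b, σ => { σ with reg := Function.update σ.reg d (σ.reg a + σ.reg b) }
  | .sub d a b, σ => { σ with reg := Function.update σ.reg d (σ.reg a - σ.reg b) }
  | .load d a, σ => { σ with reg := Function.update σ.reg d (σ.mem (σ.reg a)) }
  | .store a b, σ => { σ with mem := Function.update σ.mem (σ.reg a) (σ.reg b) }

/-- Programs. -/
inductive Program where
  | skip
  | op (o : Op)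
  | seq (P Q : Program)
  /-- if `R r ≠ 0` then `P` else `Q` -/
  | branch (r : ℕ) (P Q : Program)
  /-- while `R r ≠ 0` do `P` -/
  | loop (r : ℕ) (P : Program)

/-- What an elementary instruction, and the test whether a register is zero, cost in a state. -/
structure CostModel where
  op : Op → State → ℕ
  test : ℕ → State → ℕ

/-- Uniform cost: every instruction and every test is one step. -/
def unitCost : CostModel where
  op _ _ := 1
  test _ _ := 1

/-- Logarithmic cost: an instruction or a test costs one plus the number of binary digits of the
numbers and addresses that it works on. -/
def logCost : CostModel where
  op o σ := match o with
    | .const _ c => 1 + c.size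
    | .add _ a b => 1 + (σ.reg a).size + (σ.reg b).size
    | .sub _ a b => 1 + (σ.reg a).size + (σ.reg b).size
    | .load _ a => 1 + (σ.reg a).size + (σ.mem (σ.reg a)).size
    | .store a b => 1 + (σ.reg a).size + (σ.reg b).size
  test r σ := 1 + (σ.reg r).size

/-- `Exec κ P σ t τ`: started in the state `σ`, the program `P` halts in the state `τ`, and the
total cost of the instructions and tests that it executes is `t`. -/
inductive Exec (κ : CostModel) : Program → State → ℕ → State → Prop where
  | skip (σ : State) : Exec κ .skip σ 0 σ
  | op (o : Op) (σ : State) : Exec κ (.op o) σ (κ.op o σ) (o.run σ)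
  | seq {P Q : Program} {σ τ υ : State} {t u : ℕ} :
      Exec κ P σ t τ → Exec κ Q τ u υ → Exec κ (.seq P Q) σ (t + u) υ
  | branchTrue {r : ℕ} {P Q : Program} {σ τ : State} {t : ℕ} :
      σ.reg r ≠ 0 → Exec κ P σ t τ → Exec κ (.branch r P Q) σ (κ.test r σ + t) τ
  | branchFalse {r : ℕ} {P Q : Program} {σ τ : State} {t : ℕ} :
      σ.reg r = 0 → Exec κ Q σ t τ → Exec κ (.branch r P Q) σ (κ.test r σ + t) τ
  | loopTrue {r : ℕ} {P : Program} {σ τ υ : State} {t u : ℕ} :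
      σ.reg r ≠ 0 → Exec κ P σ t τ → Exec κ (.loop r P) τ u υ →
        Exec κ (.loop r P) σ (κ.test r σ + t + u) υ
  | loopFalse {r : ℕ} {P : Program} {σ : State} :
      σ.reg r = 0 → Exec κ (.loop r P) σ (κ.test r σ) σ

/-- The initial state on an input: the memory holds the input from address `0` on, register `0`
holds its length, and everything else is zero. -/
def start (w : List ℕ) : State where
  reg := fun i => if i = 0 then w.length else 0
  mem := fun i => w.getD i 0

/-- On the input `w`, the program halts within cost `T` and leaves in register `0` the answer to
`A`: one for yes, zero for no. -/
def Answers (κ : CostModel) (P : Program) (w : List ℕ) (A : Prop) (T : ℕ) : Prop :=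
  ∃ t τ, Exec κ P (start w) t τ ∧ t ≤ T ∧ (A → τ.reg 0 = 1) ∧ (¬ A → τ.reg 0 = 0)

/-- The length in bits of an input: every number is written in binary and followed by a
separator. -/
def bitLength (w : List ℕ) : ℕ :=
  (w.map fun a => a.size + 1).sum

/-- The decision problem with instances `α`, encoded by `enc`, and yes-instances `A` is in `P`:
some program decides it with logarithmic cost polynomial in the bit length of the input. -/
def InP {α : Type} (enc : α → List ℕ) (A : α → Prop) : Prop :=
  ∃ (P : Program) (p : Polynomial ℕ),
    ∀ x : α, Answers logCost P (enc x) (A x) (p.eval (bitLength (enc x)))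

end RAM

/-!
The scores matter only through the lead of each team over the first team `t`, cut off at `3 * k`
when `k` rounds are left: a team that is further ahead of `t` stays ahead, and one that is further
behind stays behind. This gives `6 * k + 3` levels, `t` having one for itself. Levels decrease along
the ranking, so the levels at each rank are determined by how many teams have each level, and an
induction on `k` shows that these numbers determine whether `t` can break
(`CanBreak.of_levelEquiv`).

Since the ranking is sorted by levels, the matches in which the same four levels meet are
consecutive, and there are `O(k)` kinds of matches. Permuting the outcomes of matches of the same
kind does not affect the number of teams at each level after the round. Hence the outcomes within
each kind can be sorted by the permutation in which the points are distributed, and then the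
outcome of a round is piecewise constant along the ranking, with at most `24` pieces for each kind
(`exists_levelEquiv_next`). A change from one permutation to the next is a product of at most nine
adjacent transpositions, each applied from a certain match on. So a round is described by a code of
`O(k)` numbers less than `n` (`exists_code`), and all rounds together by `O(k ^ 2)` numbers
(`canBreak_iff`).

The program tries all codes. It counts up in base `n`, plays the rounds as each code prescribes,
and looks at the final rank of the first team (`runs_breakProg`). This takes `n ^ O(k ^ 2)` steps
(`breakTime_le`). For a fixed number of rounds this is polynomial, and also under logarithmic cost,
because in one step the longest number grows by at most one digit
(`RAM.Exec.logCost_of_unitCost`).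
-/

namespace RAM

/-! ### Running time under uniform and under logarithmic cost -/

/-- `Runs P T σ τ`: started in `σ`, the program `P` halts in `τ` after at most `T` steps. -/
def Runs (P : Program) (T : ℕ) (σ τ : State) : Prop :=
  ∃ t ≤ T, Exec unitCost P σ t τ

/-- The sequence of the given elementary instructions. -/
def block : List Op → Program
  | [] => .skip
  | o :: l => .seq (.op o) (block l)

/-- The effect of a sequence of elementary instructions. -/
def runAll : List Op → State → State
  | [], σ => σ
  | o :: l, σ => runAll l (o.run σ)

theorem Runs.mono {P : Program} {T U : ℕ} {σ τ : State} (h : Runs P T σ τ) (hTU : T ≤ U) :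
    Runs P U σ τ := by
  obtain ⟨t, ht, h⟩ := h
  exact ⟨t, ht.trans hTU, h⟩

theorem Runs.skip (σ : State) : Runs .skip 0 σ σ :=
  ⟨0, le_rfl, .skip σ⟩

theorem Runs.op (o : Op) (σ : State) : Runs (.op o) 1 σ (o.run σ) :=
  ⟨1, le_rfl, .op (κ := unitCost) o σ⟩

theorem Runs.seq {P Q : Program} {T U : ℕ} {σ τ υ : State} (h₁ : Runs P T σ τ)
    (h₂ : Runs Q U τ υ) : Runs (.seq P Q) (T + U) σ υ := by
  obtain ⟨t, ht, h₁⟩ := h₁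
  obtain ⟨u, hu, h₂⟩ := h₂
  exact ⟨t + u, by omega, .seq h₁ h₂⟩

theorem Runs.block (l : List Op) (σ : State) : Runs (block l) l.length σ (runAll l σ) := by
  induction l generalizing σ with
  | nil => exact .skip σ
  | cons o l ih => exact ((Runs.op o σ).seq (ih _)).mono (by simp [add_comm])

theorem Runs.branchTrue {P Q : Program} {r T : ℕ} {σ τ : State} (hr : σ.reg r ≠ 0)
    (h : Runs P T σ τ) : Runs (.branch r P Q) (1 + T) σ τ := by
  obtain ⟨t, ht, h⟩ := h
  exact ⟨1 + t, by omega, .branchTrue (κ := unitCost) hr h⟩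

theorem Runs.branchFalse {P Q : Program} {r T : ℕ} {σ τ : State} (hr : σ.reg r = 0)
    (h : Runs Q T σ τ) : Runs (.branch r P Q) (1 + T) σ τ := by
  obtain ⟨t, ht, h⟩ := h
  exact ⟨1 + t, by omega, .branchFalse (κ := unitCost) hr h⟩

/-- The rule for loops with a loop invariant `I i` that may depend on the number `i` of completed
iterations, a bound `N` on the number of iterations and a bound `B` on the time of each. -/
theorem Runs.loop {P : Program} {r : ℕ} (I : ℕ → State → Prop) (N B : ℕ)
    (hstep : ∀ i σ, I i σ → σ.reg r ≠ 0 → i < N ∧ ∃ τ, Runs P B σ τ ∧ I (i + 1) τ)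
    {σ : State} (h0 : I 0 σ) :
    ∃ i τ, Runs (.loop r P) (N * (B + 1) + 1) σ τ ∧ I i τ ∧ i ≤ N ∧ τ.reg r = 0 := by
  suffices H : ∀ m i σ, i + m = N → I i σ →
      ∃ j τ, Runs (.loop r P) (m * (B + 1) + 1) σ τ ∧ I j τ ∧ j ≤ N ∧ τ.reg r = 0 from
    H N 0 σ (by omega) h0
  intro m
  induction m with
  | zero =>
    intro i σ hi h
    have hr : σ.reg r = 0 := by
      by_contra hr
      have := (hstep i σ h hr).1
      omega
    exact ⟨i, σ, ⟨1, by omega, .loopFalse (κ := unitCost) hr⟩, h, by omega, hr⟩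
  | succ m ih =>
    intro i σ hi h
    by_cases hr : σ.reg r = 0
    · exact ⟨i, σ, ⟨1, by omega, .loopFalse (κ := unitCost) hr⟩, h, by omega, hr⟩
    · obtain ⟨-, τ, ⟨t, ht, hP⟩, hτ⟩ := hstep i σ h hr
      obtain ⟨j, υ, ⟨u, hu, hL⟩, hj⟩ := ih (i + 1) τ (by omega) hτ
      refine ⟨j, υ, ⟨1 + t + u, ?_, .loopTrue (κ := unitCost) hr hP hL⟩, hj⟩
      rw [add_mul]
      omega

/-- The registers that an instruction may change. -/
def Op.writes : Op → List ℕ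
  | .const d _ => [d]
  | .add d _ _ => [d]
  | .sub d _ _ => [d]
  | .load d _ => [d]
  | .store _ _ => []

/-- The registers that a program may change. -/
def Program.writes : Program → List ℕ
  | .skip => []
  | .op o => o.writes
  | .seq P Q => P.writes ++ Q.writes
  | .branch _ P Q => P.writes ++ Q.writes
  | .loop _ P => P.writes

theorem Exec.reg_eq {κ : CostModel} {P : Program} {σ τ : State} {t : ℕ} (h : Exec κ P σ t τ)
    {r : ℕ} (hr : r ∉ P.writes) : τ.reg r = σ.reg r := by
  induction h with
  | skip => rfl
  | op o σ =>
    cases o <;> simp_all [Program.writes, Op.writes, Op.run, Function.update_of_ne]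
  | seq _ _ ih₁ ih₂ =>
    simp only [Program.writes, List.mem_append, not_or] at hr
    rw [ih₂ hr.2, ih₁ hr.1]
  | branchTrue _ _ ih =>
    simp only [Program.writes, List.mem_append, not_or] at hr
    exact ih hr.1
  | branchFalse _ _ ih =>
    simp only [Program.writes, List.mem_append, not_or] at hr
    exact ih hr.2
  | loopTrue _ _ _ ih₁ ih₂ => rw [ih₂ hr, ih₁ hr]
  | loopFalse => rfl

/-- A program does not change the registers that it does not write to. -/
theorem Runs.reg_eq {P : Program} {T : ℕ} {σ τ : State} (h : Runs P T σ τ) (r : ℕ)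
    (hr : r ∉ P.writes) : τ.reg r = σ.reg r := by
  obtain ⟨t, -, h⟩ := h
  exact h.reg_eq hr

/-- The rule for loops that run exactly `N` times. The registers that the body does not write to
keep their values throughout. -/
theorem Runs.forLoop {P : Program} {r : ℕ} {σ : State} (I : ℕ → State → Prop) (N B : ℕ)
    (h0 : I 0 σ)
    (hr : ∀ i ≤ N, ∀ τ, (∀ x ∉ P.writes, τ.reg x = σ.reg x) → I i τ → (τ.reg r = 0 ↔ i = N))
    (hstep : ∀ i < N, ∀ τ, (∀ x ∉ P.writes, τ.reg x = σ.reg x) → I i τ →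
      ∃ υ, Runs P B τ υ ∧ I (i + 1) υ) :
    ∃ τ, Runs (.loop r P) (N * (B + 1) + 1) σ τ ∧ I N τ := by
  obtain ⟨i, τ, hrun, ⟨hi, hf, hI⟩, -, h⟩ := Runs.loop (P := P) (r := r) (σ := σ)
    (fun i τ => i ≤ N ∧ (∀ x ∉ P.writes, τ.reg x = σ.reg x) ∧ I i τ) N B
    (fun i τ ⟨hi, hf, hI⟩ hne => by
      have hiN : i < N := lt_of_le_of_ne hi fun h => hne ((hr i hi τ hf hI).2 h)
      obtain ⟨υ, hrun, hυ⟩ := hstep i hiN τ hf hI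
      exact ⟨hiN, υ, hrun, hiN, fun x hx => (hrun.reg_eq x hx).trans (hf x hx), hυ⟩)
    ⟨Nat.zero_le N, fun _ _ => rfl, h0⟩
  obtain rfl := (hr i hi τ hf hI).1 h
  exact ⟨τ, hrun, hI⟩

/-- The largest constant in an instruction. -/
def Op.maxConst : Op → ℕ
  | .const _ c => c
  | _ => 0

/-- The largest constant in a program. -/
def Program.maxConst : Program → ℕ
  | .skip => 0
  | .op o => o.maxConst
  | .seq P Q => max P.maxConst Q.maxConst
  | .branch _ P Q => max P.maxConst Q.maxConst
  | .loop _ P => P.maxConst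

/-- All numbers in the registers and in the memory have at most `m` binary digits. -/
def State.SizeLE (σ : State) (m : ℕ) : Prop :=
  (∀ i, (σ.reg i).size ≤ m) ∧ ∀ i, (σ.mem i).size ≤ m

theorem State.SizeLE.mono {σ : State} {m m' : ℕ} (h : σ.SizeLE m) (hm : m ≤ m') : σ.SizeLE m' :=
  ⟨fun i => (h.1 i).trans hm, fun i => (h.2 i).trans hm⟩

theorem size_add_le {a b m : ℕ} (ha : a.size ≤ m) (hb : b.size ≤ m) : (a + b).size ≤ m + 1 := by
  rw [Nat.size_le] at *
  rw [pow_succ]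
  omega

theorem size_update_le {f : ℕ → ℕ} {m : ℕ} (hf : ∀ i, (f i).size ≤ m) (d : ℕ) {v : ℕ}
    (hv : v.size ≤ m + 1) (i : ℕ) : (Function.update f d v i).size ≤ m + 1 := by
  rw [Function.update_apply]
  split_ifs
  · exact hv
  · exact (hf i).trans (Nat.le_succ m)

theorem State.SizeLE.run {σ : State} {m : ℕ} (h : σ.SizeLE m) (o : Op)
    (ho : o.maxConst.size ≤ m) : (o.run σ).SizeLE (m + 1) := by
  have h' := h.mono (Nat.le_succ m)
  cases o with
  | const d c => exact ⟨size_update_le h.1 d (ho.trans (Nat.le_succ m)), h'.2⟩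
  | add d a b => exact ⟨size_update_le h.1 d (size_add_le (h.1 a) (h.1 b)), h'.2⟩
  | sub d a b =>
    exact ⟨size_update_le h.1 d ((Nat.size_le_size (Nat.sub_le _ _)).trans (h'.1 a)), h'.2⟩
  | load d a => exact ⟨size_update_le h.1 d (h'.2 _), h'.2⟩
  | store a b => exact ⟨h'.1, size_update_le h.2 _ (h'.1 b)⟩

/-- One instruction lengthens the longest number by at most one digit, so `t` steps have
logarithmic cost at most quadratic in `t`. -/
theorem Exec.logCost_of_unitCost {P : Program} {σ τ : State} {t : ℕ} (h : Exec unitCost P σ t τ) :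
    ∀ m, σ.SizeLE m → P.maxConst.size ≤ m →
      τ.SizeLE (m + t) ∧ ∃ u ≤ t * (1 + 2 * (m + t)), Exec logCost P σ u τ := by
  induction h with
  | skip σ => exact fun m hσ _ => ⟨hσ, 0, by simp, .skip σ⟩
  | op o σ =>
    intro m hσ hP
    refine ⟨hσ.run o hP, _, ?_, .op o σ⟩
    simp only [unitCost, one_mul]
    cases o with
    | const d c =>
      have : c.size ≤ m := hP
      simp only [logCost]
      omega
    | add d a b => have := hσ.1 a; have := hσ.1 b; simp only [logCost]; omega
    | sub d a b => have := hσ.1 a; have := hσ.1 b; simp only [logCost]; omega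
    | load d a => have := hσ.1 a; have := hσ.2 (σ.reg a); simp only [logCost]; omega
    | store a b => have := hσ.1 a; have := hσ.1 b; simp only [logCost]; omega
  | @seq P Q σ τ υ t u _ _ ih₁ ih₂ =>
    intro m hσ hP
    have hP₁ := (Nat.size_le_size (le_max_left P.maxConst Q.maxConst)).trans hP
    have hP₂ := (Nat.size_le_size (le_max_right P.maxConst Q.maxConst)).trans hP
    obtain ⟨hτ, t', ht', h₁⟩ := ih₁ m hσ hP₁
    obtain ⟨hυ, u', hu', h₂⟩ := ih₂ (m + t) hτ (by omega)
    refine ⟨hυ.mono (by omega), t' + u', (add_le_add ht' hu').trans ?_, .seq h₁ h₂⟩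
    nlinarith
  | @branchTrue r P Q σ τ t hr _ ih =>
    intro m hσ hP
    obtain ⟨hτ, t', ht', h₁⟩ :=
      ih m hσ ((Nat.size_le_size (le_max_left P.maxConst Q.maxConst)).trans hP)
    refine ⟨hτ.mono (by omega), _, ?_, .branchTrue hr h₁⟩
    have := hσ.1 r
    simp only [logCost, unitCost]
    nlinarith
  | @branchFalse r P Q σ τ t hr _ ih =>
    intro m hσ hP
    obtain ⟨hτ, t', ht', h₁⟩ :=
      ih m hσ ((Nat.size_le_size (le_max_right P.maxConst Q.maxConst)).trans hP)
    refine ⟨hτ.mono (by omega), _, ?_, .branchFalse hr h₁⟩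
    have := hσ.1 r
    simp only [logCost, unitCost]
    nlinarith
  | @loopTrue r P σ τ υ t u hr _ _ ih₁ ih₂ =>
    intro m hσ hP
    obtain ⟨hτ, t', ht', h₁⟩ := ih₁ m hσ hP
    obtain ⟨hυ, u', hu', h₂⟩ := ih₂ (m + t) hτ (le_add_right hP)
    refine ⟨hυ.mono (by omega), _, ?_, .loopTrue hr h₁ h₂⟩
    have := hσ.1 r
    simp only [logCost, unitCost]
    nlinarith
  | @loopFalse r P σ hr =>
    intro m hσ hP
    refine ⟨hσ.mono (by omega), _, ?_, .loopFalse hr⟩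
    have := hσ.1 r
    simp only [logCost, unitCost]
    omega

theorem size_le_bitLength {w : List ℕ} {a : ℕ} (ha : a ∈ w) : a.size ≤ bitLength w :=
  (Nat.le_succ _).trans (List.single_le_sum (by simp) _ (List.mem_map_of_mem ha))

theorem length_le_bitLength (w : List ℕ) : w.length ≤ bitLength w := by
  induction w with
  | nil => simp
  | cons a w ih => simp only [bitLength, List.map_cons, List.sum_cons, List.length_cons] at *; omega

theorem size_le_self (a : ℕ) : a.size ≤ a := Nat.size_le.2 Nat.lt_two_pow_self

theorem sizeLE_start (w : List ℕ) : (start w).SizeLE (bitLength w) := by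
  refine ⟨fun i => ?_, fun i => ?_⟩
  · simp only [start]
    split_ifs
    · exact (size_le_self _).trans (length_le_bitLength w)
    · simp
  · simp only [start]
    by_cases hi : i < w.length
    · rw [List.getD_eq_getElem _ _ hi]
      exact size_le_bitLength (List.getElem_mem hi)
    · rw [List.getD_eq_default _ _ (by omega)]
      simp

/-- A problem that is solved in polynomially many steps is in `P`. -/
theorem inP_of_unitCost {α : Type} {enc : α → List ℕ} {A : α → Prop} {P : Program} {e : ℕ}
    (h : ∀ x, Answers unitCost P (enc x) (A x) ((enc x).length ^ e)) : InP enc A := by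
  refine ⟨P, .X ^ e * (1 + 2 * (.X + .C P.maxConst.size + .X ^ e)), fun x => ?_⟩
  obtain ⟨t, τ, hP, ht, hA⟩ := h x
  have ht' : t ≤ bitLength (enc x) ^ e :=
    ht.trans (Nat.pow_le_pow_left (length_le_bitLength _) e)
  obtain ⟨-, u, hu, hlog⟩ := hP.logCost_of_unitCost (bitLength (enc x) + P.maxConst.size)
    ((sizeLE_start _).mono (by omega)) (by omega)
  refine ⟨u, τ, hlog, hu.trans ?_, hA⟩
  simp only [Polynomial.eval_mul, Polynomial.eval_add, Polynomial.eval_pow, Polynomial.eval_X,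
    Polynomial.eval_C, Polynomial.eval_one, Polynomial.eval_ofNat]
  gcongr

end RAM

namespace Debating

/-! ### Ranks -/

section Rank

variable {n : ℕ} {s : Fin n → ℕ} {i j : Fin n}

theorem not_before_self (s : Fin n → ℕ) (i : Fin n) : ¬ Before s i i := by
  simp [Before]

theorem Before.trans {l : Fin n} (h : Before s i j) (h' : Before s j l) : Before s i l := by
  unfold Before at *
  omega

theorem before_or_before (s : Fin n → ℕ) (h : i ≠ j) : Before s i j ∨ Before s j i := by
  unfold Before
  omega

theorem rank_lt (s : Fin n → ℕ) (i : Fin n) : rank s i < n := by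
  have h : (Finset.univ.filter fun j => Before s j i).card < (Finset.univ : Finset (Fin n)).card :=
    Finset.card_lt_card <| (Finset.filter_ssubset).2 ⟨i, Finset.mem_univ i, not_before_self s i⟩
  simpa [rank] using h

theorem rank_lt_rank (h : Before s i j) : rank s i < rank s j := by
  refine Finset.card_lt_card ((Finset.ssubset_iff_of_subset fun l hl => ?_).2 ⟨i, ?_, ?_⟩)
  · simp only [Finset.mem_filter, Finset.mem_univ, true_and] at *
    exact hl.trans h
  · simpa using h
  · simpa using not_before_self s i

theorem rank_injective (s : Fin n → ℕ) : Function.Injective (rank s) := by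
  intro i j h
  by_contra hij
  rcases before_or_before s hij with h' | h' <;> have := rank_lt_rank h' <;> omega

/-- The bijection between teams and ranks. -/
noncomputable def rankEquiv (s : Fin n → ℕ) : Fin n ≃ Fin n :=
  Equiv.ofBijective (fun i => ⟨rank s i, rank_lt s i⟩) <| Finite.injective_iff_bijective.1
    fun _ _ h => rank_injective s (Fin.mk.inj h)

theorem rankEquiv_val (s : Fin n → ℕ) (i : Fin n) : (rankEquiv s i : ℕ) = rank s i := rfl

theorem rank_symm (s : Fin n → ℕ) (r : Fin n) : rank s ((rankEquiv s).symm r) = r := by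
  rw [← rankEquiv_val, Equiv.apply_symm_apply]

theorem before_of_rank_lt (h : rank s i < rank s j) : Before s i j := by
  have hij : i ≠ j := by
    rintro rfl
    exact lt_irrefl _ h
  refine (before_or_before s hij).resolve_right fun h' => ?_
  have := rank_lt_rank h'
  omega

end Rank

/-! ### Levels -/

section Level

variable {n : ℕ} {t : Fin n}

/-- The level of team `i` when `k` rounds are left: its lead over `t`, shifted by `3 * k` and cut
off at the leads that can no longer change sides. The level `3 * k + 1` is that of `t` alone; the
teams with more points than `t` have higher levels, and the other teams have lower levels. -/
def level (t : Fin n) (k : ℕ) (s : Fin n → ℕ) (i : Fin n) : ℕ :=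
  if i = t then 3 * k + 1
  else if s i ≤ s t then s i + 3 * k - s t
  else min (s i + 3 * k + 1 - s t) (6 * k + 2)

/-- The scores `s` and `s'` agree up to a permutation of the teams, as far as levels are
concerned. -/
def LevelEquiv (t : Fin n) (k : ℕ) (s s' : Fin n → ℕ) : Prop :=
  ∃ e : Equiv.Perm (Fin n), ∀ i, level t k s' i = level t k s (e i)

theorem level_le (t : Fin n) (k : ℕ) (s : Fin n → ℕ) (i : Fin n) : level t k s i ≤ 6 * k + 2 := by
  unfold level
  split_ifs <;> omega

theorem level_eq_iff (k : ℕ) (s : Fin n → ℕ) (i : Fin n) :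
    level t k s i = 3 * k + 1 ↔ i = t := by
  unfold level
  split_ifs <;> simp only [*, iff_false] <;> omega

theorem lt_level_iff (k : ℕ) (s : Fin n → ℕ) (i : Fin n) :
    3 * k + 1 < level t k s i ↔ s t < s i := by
  unfold level
  split_ifs with h
  · subst h
    simp
  · omega
  · omega

theorem level_le_level (ht : ∀ i, t ≤ i) (k : ℕ) {s : Fin n → ℕ} {i j : Fin n}
    (h : Before s i j) : level t k s j ≤ level t k s i := by
  have hi := ht i
  have hj := ht j
  unfold Before at h
  by_cases hit : i = t
  · subst hit
    unfold level
    split_ifs <;> omega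
  by_cases hjt : j = t
  · subst hjt
    unfold level
    split_ifs <;> omega
  simp only [level, hit, hjt, if_false]
  split_ifs <;> omega

theorem antitone_level (ht : ∀ i, t ≤ i) (k : ℕ) (s : Fin n → ℕ) :
    Antitone (level t k s ∘ (rankEquiv s).symm) := by
  intro r r' h
  rcases h.eq_or_lt with rfl | h
  · exact le_rfl
  · refine level_le_level ht k (before_of_rank_lt ?_)
    rw [rank_symm, rank_symm]
    exact h

/-- The levels before a round and the points scored in it determine the levels after the round. -/
theorem level_add {k : ℕ} {s s' : Fin n → ℕ} {p p' : Fin n → Fin 4} {i i' : Fin n}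
    (h : level t (k + 1) s i = level t (k + 1) s' i') (hp : p i = p' i') (ht : p t = p' t) :
    level t k (fun i => s i + (p i : ℕ)) i = level t k (fun i => s' i + (p' i : ℕ)) i' := by
  have hi : i = t ↔ i' = t := by rw [← level_eq_iff (k + 1) s, h, level_eq_iff]
  have h₁ := (p i).isLt
  have h₂ := (p t).isLt
  by_cases hit : i = t
  · simp [level, hit, hi.1 hit]
  · have hit' := fun h' => hit (hi.2 h')
    simp only [level, hit, if_false, ← hp, ← ht] at h ⊢
    split_ifs at h ⊢ <;> omega

/-- Scores that agree in their levels up to a permutation of the teams agree in their levels at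
each rank, since the levels decrease along the ranking. -/
theorem LevelEquiv.exists_rank_eq (ht : ∀ i, t ≤ i) {k : ℕ} {s s' : Fin n → ℕ}
    (h : LevelEquiv t k s s') :
    ∃ e : Equiv.Perm (Fin n), (∀ i, level t k s' i = level t k s (e i)) ∧
      ∀ i, rank s (e i) = rank s' i := by
  obtain ⟨e, he⟩ := h
  have h₁ := antitone_level ht k s
  have h₂ := antitone_level ht k s'
  have h₃ : level t k s' = level t k s ∘ e := funext he
  rw [h₃, Function.comp_assoc, ← Equiv.coe_trans] at h₂
  have h₄ := Tuple.unique_antitone h₂ h₁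
  refine ⟨(rankEquiv s').trans (rankEquiv s).symm, fun i => ?_, fun i => ?_⟩
  · have := congrFun h₄ (rankEquiv s' i)
    simpa [he] using this
  · rw [Equiv.trans_apply, rank_symm, rankEquiv_val]

theorem CanBreak.of_levelEquiv (ht : ∀ i, t ≤ i) {b k : ℕ} {s s' : Fin n → ℕ}
    (h : LevelEquiv t k s s') (hs : CanBreak t b k s) : CanBreak t b k s' := by
  induction k generalizing s s' with
  | zero =>
    obtain ⟨e, he⟩ := h
    refine (Finset.card_equiv e fun i => ?_).trans_lt hs
    simp only [Finset.mem_filter, Finset.mem_univ, true_and]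
    rw [← lt_level_iff 0 s', ← lt_level_iff 0 s, he]
  | succ k ih =>
    obtain ⟨e, he, hr⟩ := h.exists_rank_eq ht
    obtain ⟨p, hp, hs⟩ := hs
    have het : e t = t := by rw [← level_eq_iff (k + 1) s, ← he, level_eq_iff]
    refine ⟨fun i => p (e i), fun i j hij hm => ?_, ih ⟨e, fun i => ?_⟩ hs⟩
    · refine hp _ _ (e.injective.ne hij) ?_
      rw [matchOf, matchOf, hr, hr]
      exact hm
    · exact level_add (p := fun i => p (e i)) (he i) rfl (congrArg p het)

end Level

/-! ### Tables of points -/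

/-- The transposition of the residues `j` and `j + 1` modulo `4`. -/
def swapMod (j x : ℕ) : ℕ :=
  if x % 4 = j then x + 1 else if x % 4 = j + 1 then x - 1 else x

/-- The table `F`, with the entries `j` and `j + 1` of every match from match `d` on exchanged. -/
def swapFrom (j d : ℕ) (F : ℕ → ℕ) (x : ℕ) : ℕ :=
  if d ≤ x / 4 then F (swapMod j x) else F x

/-- The points for each rank according to the code `g`. In the initial table the four teams of a
match score `0, 1, 2, 3` in the order of their ranks; then, for each `x < 3 * q`, the entries
`x % 3` and `x % 3 + 1` of all matches from match `g x` on are exchanged. -/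
def table (g : ℕ → ℕ) : ℕ → ℕ → ℕ
  | 0 => fun x => x % 4
  | q + 1 => swapFrom 2 (g (3 * q + 2)) <| swapFrom 1 (g (3 * q + 1)) <|
      swapFrom 0 (g (3 * q)) <| table g q

/-- The permutation by which match `m` is played according to `table g q`. -/
def tablePerm (g : ℕ → ℕ) (m : ℕ) : ℕ → Equiv.Perm (Fin 4)
  | 0 => 1
  | q + 1 => tablePerm g m q * ((if g (3 * q) ≤ m then Equiv.swap 0 1 else 1) *
      (if g (3 * q + 1) ≤ m then Equiv.swap 1 2 else 1) *
      (if g (3 * q + 2) ≤ m then Equiv.swap 2 3 else 1))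

theorem swapMod_eq (m : ℕ) (i : Fin 4) :
    swapMod 0 (4 * m + i) = 4 * m + (Equiv.swap 0 1 i : Fin 4) ∧
    swapMod 1 (4 * m + i) = 4 * m + (Equiv.swap 1 2 i : Fin 4) ∧
    swapMod 2 (4 * m + i) = 4 * m + (Equiv.swap 2 3 i : Fin 4) := by
  have h : (4 * m + i : ℕ) % 4 = i := by omega
  simp only [swapMod, h]
  fin_cases i <;> simp <;> decide

theorem table_eq (g : ℕ → ℕ) (m q : ℕ) (i : Fin 4) :
    table g q (4 * m + i) = tablePerm g m q i := by
  have h (i : Fin 4) : (4 * m + i : ℕ) / 4 = m := by omega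
  induction q generalizing i with
  | zero =>
    simp only [table, tablePerm, Equiv.Perm.one_apply]
    omega
  | succ q ih =>
    simp only [table, tablePerm, swapFrom, Equiv.Perm.mul_apply, h, swapMod_eq]
    split_ifs <;> simp only [ih, Equiv.Perm.one_apply]

theorem table_lt (g : ℕ → ℕ) (q x : ℕ) : table g q x < 4 := by
  have h := table_eq g (x / 4) q ⟨x % 4, Nat.mod_lt _ (by norm_num)⟩
  rw [show 4 * (x / 4) + x % 4 = x from Nat.div_add_mod x 4] at h
  rw [h]
  exact Fin.isLt _

theorem table_inj (g : ℕ → ℕ) (q : ℕ) {x y : ℕ} (hxy : x / 4 = y / 4)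
    (h : table g q x = table g q y) : x = y := by
  have hx := table_eq g (x / 4) q ⟨x % 4, Nat.mod_lt _ (by norm_num)⟩
  have hy := table_eq g (y / 4) q ⟨y % 4, Nat.mod_lt _ (by norm_num)⟩
  rw [show 4 * (x / 4) + x % 4 = x from Nat.div_add_mod x 4] at hx
  rw [show 4 * (y / 4) + y % 4 = y from Nat.div_add_mod y 4] at hy
  rw [hx, hy, hxy, Fin.val_inj, (tablePerm g (y / 4) q).injective.eq_iff, Fin.mk.injEq] at h
  omega

theorem table_congr {g g' : ℕ → ℕ} {q : ℕ} (h : ∀ x < 3 * q, g x = g' x) :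
    table g q = table g' q := by
  induction q with
  | zero => rfl
  | succ q ih =>
    simp only [table]
    rw [ih fun x hx => h x (by omega), h _ (by omega), h _ (by omega), h _ (by omega)]

/-- Nine adjacent transpositions, of which some are omitted, give every permutation of four
elements. -/
theorem exists_word (ρ : Equiv.Perm (Fin 4)) : ∃ c : ℕ → Bool,
    ((if c 0 then Equiv.swap 0 1 else 1) * (if c 1 then Equiv.swap 1 2 else 1) *
      (if c 2 then Equiv.swap 2 3 else 1)) *
    ((if c 3 then Equiv.swap 0 1 else 1) * (if c 4 then Equiv.swap 1 2 else 1) *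
      (if c 5 then Equiv.swap 2 3 else 1)) *
    ((if c 6 then Equiv.swap 0 1 else 1) * (if c 7 then Equiv.swap 1 2 else 1) *
      (if c 8 then Equiv.swap 2 3 else 1)) = ρ := by
  have h : ∀ ρ : Equiv.Perm (Fin 4), ∃ c₀ c₁ c₂ c₃ c₄ c₆ : Bool,
      ((if c₀ then Equiv.swap 0 1 else 1) * (if c₁ then Equiv.swap 1 2 else 1) *
        (if c₂ then Equiv.swap 2 3 else 1)) *
      ((if c₃ then Equiv.swap 0 1 else 1) * (if c₄ then Equiv.swap 1 2 else 1)) *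
      (if c₆ then Equiv.swap 0 1 else 1) = ρ := by
    decide +kernel
  obtain ⟨c₀, c₁, c₂, c₃, c₄, c₆, h⟩ := h ρ
  refine ⟨fun x => [c₀, c₁, c₂, c₃, c₄, false, c₆].getD x false, ?_⟩
  simpa using h

theorem exists_threshold {N : ℕ} {κ : Fin N → ℕ} (hκ : Monotone κ) (c : ℕ) :
    ∃ d ≤ N, ∀ m : Fin N, d ≤ m ↔ c ≤ κ m := by
  have hex : ∃ d, ∀ h : d < N, c ≤ κ ⟨d, h⟩ := ⟨N, fun h => absurd h (lt_irrefl N)⟩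
  classical
  refine ⟨Nat.find hex, Nat.find_min' hex fun h => absurd h (lt_irrefl N), fun m => ⟨fun h => ?_,
    fun h => Nat.find_min' hex fun _ => h⟩⟩
  exact (Nat.find_spec hex (h.trans_lt m.isLt)).trans (hκ h)

/-- Every assignment of permutations to matches that is constant on `Z` consecutive intervals is
given by a code. -/
theorem exists_code {N Z q : ℕ} {κ : Fin N → ℕ} (hκ : Monotone κ) (hZ : ∀ m, κ m < Z)
    (hq : 3 * Z ≤ q) (T : ℕ → Equiv.Perm (Fin 4)) :
    ∃ g : ℕ → ℕ, (∀ x, g x ≤ N) ∧ ∀ m : Fin N, tablePerm g m q = T (κ m) := by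
  choose d hdN hd using exists_threshold hκ
  -- Until interval `0` begins, the permutation is the identity.
  let T' : ℕ → Equiv.Perm (Fin 4) := fun c => if c = 0 then 1 else T (c - 1)
  choose w hw using fun c => exists_word ((T' c)⁻¹ * T' (c + 1))
  let g : ℕ → ℕ := fun x => if x / 9 < Z ∧ w (x / 9) (x % 9) then d (x / 9) else N
  refine ⟨g, fun x => ?_, fun m => ?_⟩
  · simp only [g]
    split_ifs
    · exact hdN _
    · exact le_rfl
  have hg (c u : ℕ) (hu : u < 9) : g (9 * c + u) ≤ m ↔ c < Z ∧ w c u ∧ c ≤ κ m := by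
    have h₁ : (9 * c + u) / 9 = c := by omega
    have h₂ : (9 * c + u) % 9 = u := by omega
    simp only [g, h₁, h₂]
    split_ifs with h
    · simp [h, hd]
    · have := m.isLt
      simp only [not_and, Bool.not_eq_true] at h
      constructor
      · omega
      · rintro ⟨h₃, h₄, -⟩
        simp [h h₃] at h₄
  have key : ∀ c ≤ Z, tablePerm g m (3 * c) = T' (min c (κ m + 1)) := by
    intro c hc
    induction c with
    | zero => simp [tablePerm, T']
    | succ c ih =>
      have hcZ : c < Z := hc
      rw [show 3 * (c + 1) = 3 * c + 1 + 1 + 1 by ring]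
      simp only [tablePerm]
      rw [ih hcZ.le, show 3 * (3 * c) = 9 * c + 0 by ring,
        show 9 * c + 0 + 1 = 9 * c + 1 by ring, show 9 * c + 0 + 2 = 9 * c + 2 by ring,
        show 3 * (3 * c + 1) = 9 * c + 3 by ring, show 9 * c + 3 + 1 = 9 * c + 4 by ring,
        show 9 * c + 3 + 2 = 9 * c + 5 by ring,
        show 3 * (3 * c + 1 + 1) = 9 * c + 6 by ring, show 9 * c + 6 + 1 = 9 * c + 7 by ring,
        show 9 * c + 6 + 2 = 9 * c + 8 by ring]
      simp only [hg c _ (show 0 < 9 by norm_num), hg c _ (show 1 < 9 by norm_num),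
        hg c _ (show 2 < 9 by norm_num), hg c _ (show 3 < 9 by norm_num),
        hg c _ (show 4 < 9 by norm_num), hg c _ (show 5 < 9 by norm_num),
        hg c _ (show 6 < 9 by norm_num), hg c _ (show 7 < 9 by norm_num),
        hg c _ (show 8 < 9 by norm_num), hcZ, true_and]
      by_cases hcκ : c ≤ κ m
      · simp only [hcκ, and_true]
        rw [mul_assoc, mul_assoc, ← mul_assoc (_ * _ * _) (_ * _ * _) (_ * _ * _), hw c,
          min_eq_left (by omega), min_eq_left (by omega), mul_inv_cancel_left]
      · simp only [hcκ, and_false, if_false, mul_one]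
        rw [min_eq_right (by omega), min_eq_right (by omega)]
  have hend : ∀ r, tablePerm g m (3 * Z + r) = T (κ m) := by
    intro r
    induction r with
    | zero =>
      rw [add_zero, key Z le_rfl, min_eq_right (by have := hZ m; omega)]
      simp [T']
    | succ r ih =>
      have hN (x : ℕ) (hx : 9 * Z ≤ x) : ¬ g x ≤ m := by
        simp only [g]
        rw [if_neg (by omega)]
        have := m.isLt
        omega
      rw [← add_assoc]
      simp only [tablePerm]
      rw [if_neg (hN _ (by omega)), if_neg (hN _ (by omega)), if_neg (hN _ (by omega)), ih]
      simp
  have := hend (q - 3 * Z)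
  rwa [Nat.add_sub_cancel' hq] at this

/-! ### Playing by a code -/

/-- The scores after a round in which the points are distributed according to the table `F`. -/
def next {n : ℕ} (s : Fin n → ℕ) (F : ℕ → ℕ) (i : Fin n) : ℕ :=
  s i + F (rank s i)

/-- The scores after some rounds. A round uses up `3 * q` entries of the code `g`. -/
def scoreAfter {n : ℕ} (q : ℕ) (g : ℕ → ℕ) (s : Fin n → ℕ) : ℕ → Fin n → ℕ
  | 0 => s
  | r + 1 => next (scoreAfter q g s r) (table (fun x => g (3 * q * r + x)) q)

theorem scoreAfter_succ {n : ℕ} (q : ℕ) (g : ℕ → ℕ) (s : Fin n → ℕ) (r : ℕ) :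
    scoreAfter q g s (r + 1) =
      scoreAfter q (fun x => g (3 * q + x)) (next s (table g q)) r := by
  induction r with
  | zero => simp [scoreAfter]
  | succ r ih =>
    rw [scoreAfter, ih, scoreAfter]
    congr 2
    funext x
    congr 1
    ring

theorem scoreAfter_congr {n : ℕ} {q : ℕ} {g g' : ℕ → ℕ} (s : Fin n → ℕ) {r : ℕ}
    (h : ∀ x < 3 * q * r, g x = g' x) : scoreAfter q g s r = scoreAfter q g' s r := by
  induction r with
  | zero => rfl
  | succ r ih =>
    rw [mul_add_one] at h
    simp only [scoreAfter]
    rw [ih fun x hx => h x (by omega), table_congr fun x hx => h _ (by omega)]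

theorem canBreak_of_scoreAfter {n : ℕ} {t : Fin n} {b q : ℕ} (k : ℕ) {g : ℕ → ℕ}
    {s : Fin n → ℕ}
    (h : (Finset.univ.filter fun j => scoreAfter q g s k t < scoreAfter q g s k j).card < b) :
    CanBreak t b k s := by
  induction k generalizing g s with
  | zero => exact h
  | succ k ih =>
    simp only [scoreAfter_succ] at h
    refine ⟨fun i => ⟨table g q (rank s i), table_lt _ _ _⟩, fun i j hij hm hp => ?_, ih h⟩
    exact hij (rank_injective s (table_inj g q hm (Fin.mk.inj hp)))

/-- Every round can be replaced by one that is played by a code and leads to the same levels: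
permute the outcomes of the matches in which the same levels meet. These matches are consecutive,
so the outcomes can be sorted, and then they change only a few times. -/
theorem exists_levelEquiv_next {n : ℕ} {t : Fin n} (ht : ∀ i, t ≤ i) (h4 : 4 ∣ n) {k q : ℕ}
    (hq : 3 * (24 * (24 * k + 33)) ≤ q) (s : Fin n → ℕ) {p : Fin n → Fin 4} (hp : IsOutcome s p) :
    ∃ g : ℕ → ℕ, (∀ x, g x < n) ∧
      LevelEquiv t k (fun i => s i + (p i : ℕ)) (next s (table g q)) := by
  obtain ⟨N, rfl⟩ : ∃ N, n = N * 4 := h4.imp fun N h => by omega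
  let R : Fin N × Fin 4 ≃ Fin (N * 4) := finProdFinEquiv.trans (rankEquiv s).symm
  have hR (m : Fin N) (i : Fin 4) : rank s (R (m, i)) = 4 * m + i := by
    rw [Equiv.trans_apply, rank_symm, finProdFinEquiv_apply_val, add_comm]
  let f : Fin N × Fin 4 → ℕ := fun a => level t (k + 1) s (R a)
  have hf {m m' : Fin N} (h : m ≤ m') (i : Fin 4) : f (m', i) ≤ f (m, i) := by
    refine antitone_level ht (k + 1) s ?_
    rw [Fin.le_def, finProdFinEquiv_apply_val, finProdFinEquiv_apply_val]
    rw [Fin.le_def] at h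
    simp only
    omega
  have hfle (m : Fin N) : ∑ i, f (m, i) ≤ 24 * k + 32 := by
    refine (Finset.sum_le_card_nsmul _ _ _ fun i _ => level_le t (k + 1) s _).trans ?_
    simp
    omega
  let P : Fin N → Equiv.Perm (Fin 4) := fun m => Equiv.ofBijective (fun i => p (R (m, i))) <|
    Finite.injective_iff_bijective.1 fun i j hij => by
      by_contra hne
      refine hp _ _ (R.injective.ne (a₁ := (m, i)) (a₂ := (m, j)) (by simpa using hne)) ?_ hij
      rw [matchOf, matchOf, hR, hR]
      omega
  -- With `k + 1` rounds left, a level is at most `6 * k + 8`, so a sum of four is at most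
  -- `24 * k + 32`.
  let type : Fin N → ℕ := fun m => 24 * k + 32 - ∑ i, f (m, i)
  have htype : Monotone type := fun m m' h =>
    Nat.sub_le_sub_left (Finset.sum_le_sum fun i _ => hf h i) _
  let code : Equiv.Perm (Fin 4) ≃ Fin 24 := Fintype.equivFinOfCardEq (by
    rw [Fintype.card_perm, Fintype.card_fin]; rfl)
  let key : Fin N → ℕ := fun m => 24 * type m + code (P m)
  let σ : Equiv.Perm (Fin N) := Tuple.sort key
  have hσ : Monotone (key ∘ σ) := Tuple.monotone_sort key
  have hkey (m : Fin N) : key m / 24 = type m := by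
    have := (code (P m)).isLt
    simp only [key]
    omega
  have htσ : type ∘ σ = type := by
    have h₁ : Monotone (type ∘ σ) := fun m m' h => by
      have := Nat.div_le_div_right (c := 24) (hσ h)
      simpa only [Function.comp_apply, hkey] using this
    exact Tuple.unique_monotone (τ := 1) h₁ htype
  -- The levels decrease along the ranking, so matches with equal sums of levels have equal levels.
  have hlevel {m m' : Fin N} (hle : m ≤ m') (h : type m = type m') (i : Fin 4) :
      f (m, i) = f (m', i) := by
    have h₁ := hfle m
    have h₂ := hfle m'
    simp only [type] at h
    exact ((Finset.sum_eq_sum_iff_of_le fun i _ => hf hle i).1 (by omega) i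
      (Finset.mem_univ i)).symm
  have hfσ (m : Fin N) (i : Fin 4) : f (m, i) = f (σ m, i) := by
    have h : type (σ m) = type m := congrFun htσ m
    rcases le_total m (σ m) with hle | hle
    · exact hlevel hle h.symm i
    · exact (hlevel hle h i).symm
  obtain ⟨g, hgN, hg⟩ := exists_code (Z := 24 * (24 * k + 33)) (q := q) hσ (fun m => by
    have := (code (P (σ m))).isLt
    simp only [Function.comp_apply, key, type]
    omega) hq (fun c => code.symm ⟨c % 24, Nat.mod_lt _ (by norm_num)⟩)
  have hgP (m : Fin N) : tablePerm g m q = P (σ m) := by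
    rw [hg m, Equiv.symm_apply_eq, Fin.ext_iff]
    have := (code (P (σ m))).isLt
    simp only [Function.comp_apply, key]
    omega
  have hN : 0 < N * 4 := (Nat.zero_le _).trans_lt t.isLt
  refine ⟨g, fun x => (hgN x).trans_lt (by omega), ?_⟩
  let e : Equiv.Perm (Fin (N * 4)) :=
    R.symm.trans ((Equiv.prodCongr σ (Equiv.refl (Fin 4))).trans R)
  have he (m : Fin N) (i : Fin 4) : e (R (m, i)) = R (σ m, i) := by simp [e]
  have hev (x : Fin (N * 4)) : level t (k + 1) s x = level t (k + 1) s (e x) := by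
    obtain ⟨⟨m, i⟩, rfl⟩ := R.surjective x
    rw [he]
    exact hfσ m i
  have het : e t = t := by rw [← level_eq_iff (k + 1) s, ← hev, level_eq_iff]
  have hnext : next s (table g q) = fun x => s x + (p (e x) : ℕ) := by
    funext x
    obtain ⟨⟨m, i⟩, rfl⟩ := R.surjective x
    rw [next, hR, table_eq, hgP, he]
    rfl
  rw [hnext]
  exact ⟨e, fun x => level_add (p := fun x => p (e x)) (hev x) rfl (congrArg p het)⟩

theorem exists_scoreAfter_of_canBreak {n : ℕ} {t : Fin n} (ht : ∀ i, t ≤ i) (h4 : 4 ∣ n)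
    {b k q : ℕ} (hq : 4096 * k ≤ q) {s : Fin n → ℕ} (h : CanBreak t b k s) :
    ∃ g : ℕ → ℕ, (∀ x, g x < n) ∧
      (Finset.univ.filter fun j => scoreAfter q g s k t < scoreAfter q g s k j).card < b := by
  induction k generalizing s with
  | zero => exact ⟨fun _ => t, fun _ => t.isLt, h⟩
  | succ k ih =>
    obtain ⟨p, hp, h⟩ := h
    obtain ⟨g₀, hg₀, he⟩ := exists_levelEquiv_next ht h4 (k := k) (q := q) (by linarith) s hp
    obtain ⟨g₁, hg₁, h⟩ := ih (by omega) (h.of_levelEquiv ht he)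
    refine ⟨fun x => if x < 3 * q then g₀ x else g₁ (x - 3 * q), fun x => ?_, ?_⟩
    · simp only
      split_ifs
      · exact hg₀ x
      · exact hg₁ _
    · have h₀ : table (fun x => if x < 3 * q then g₀ x else g₁ (x - 3 * q)) q = table g₀ q :=
        table_congr fun x hx => if_pos hx
      simpa [scoreAfter_succ, h₀] using h

/-- It suffices to consider rounds that are played by codes. -/
theorem canBreak_iff {n : ℕ} {t : Fin n} (ht : ∀ i, t ≤ i) (h4 : 4 ∣ n) {b k q : ℕ}
    (hq : 4096 * k ≤ q) (s : Fin n → ℕ) : CanBreak t b k s ↔ ∃ g : ℕ → ℕ, (∀ x, g x < n) ∧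
      (Finset.univ.filter fun j => scoreAfter q g s k t < scoreAfter q g s k j).card < b :=
  ⟨exists_scoreAfter_of_canBreak ht h4 hq, fun ⟨_, _, h⟩ => canBreak_of_scoreAfter k h⟩

open RAM

/-! ### The program -/

/-!
With `n` teams and `l` rounds left, the memory contains the input from address `0` on, the table of
points of the current round from `n + 2` on, the code from `2 * n + 2` on, and after the code the
scores after each round. The following registers have fixed purposes.

* `0`: the length of the input at first, then positive if a code has been successful
* `1`: the number `n` of teams
* `2`, `3`: the first address of the table of points, and that of the code
* `4`: the first address after the code
* `5`: the length of the code for one round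
* `6`, `7`: the first addresses of the current scores and of the scores after the round
* `8`: the address of the next entry of the code
* `10`: the number of a team
* `17`: the threshold
* `18`: zero if all codes have been tried
* `20`, `21`, `22`, `25`: the constants `1`, `2`, `4`, `0`

The remaining registers are loop tests and scratch space.
-/

/-- Computes in register `12` the rank of team `i` (register `10`) under the `n` (register `1`)
scores that start at the address in register `6`. Register `20` holds `1`. The truth value of
`0 < x` is computed as `1 - (1 - x)`. -/
def rankProg : Program :=
  .seq (block [.add 14 6 10, .load 13 14, .const 11 0, .const 12 0, .sub 28 1 11]) <|
    .loop 28 <| block [.add 14 6 11, .load 14 14, .sub 23 10 11, .sub 23 20 23, .sub 23 20 23,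
      .add 14 14 23, .sub 14 14 13, .sub 14 20 14, .sub 14 20 14, .add 12 12 14, .add 11 11 20,
      .sub 28 1 11]

/-- Writes the scores after the next round to the addresses from register `7` on. The current
scores start at the address in register `6`, the table of points at that in register `2`. -/
def playProg : Program :=
  .seq (block [.const 10 0, .sub 19 1 10]) <|
    .loop 19 <| .seq rankProg <| block [.add 14 2 12, .load 14 14, .add 14 13 14, .add 23 7 10,
      .store 23 14, .add 10 10 20, .sub 19 1 10]

/-- Exchanges the entries `j` and `j + 1` of the matches from match `d` on in the table of points
between the addresses in registers `2` and `3`. The number `d` is read from the code, at the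
address in register `8`. -/
def swapProg (j : ℕ) : Program :=
  .seq (block [.load 23 8, .add 23 23 23, .add 23 23 23, .add 14 2 23, .const 24 j,
      .add 14 14 24, .add 8 8 20, .sub 19 3 14]) <|
    .loop 19 <| block [.add 24 14 20, .load 26 14, .load 27 24, .store 14 27, .store 24 26,
      .add 14 14 22, .sub 19 3 14]

/-- Writes the initial table of points. -/
def initProg : Program :=
  .seq (block [.add 14 2 25, .sub 19 3 14]) <|
    .loop 19 <| block [.store 14 25, .add 14 14 20, .store 14 20, .add 14 14 20, .store 14 21,
      .add 14 14 20, .const 24 3, .store 14 24, .add 14 14 20, .sub 19 3 14]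

/-- Plays one round by the entries of the code from the address in register `8` on, whose number
is in register `5`. -/
def roundProg : Program :=
  .seq initProg <| .seq (block [.add 9 8 5, .sub 16 9 8]) <|
    .seq (.loop 16 <| .seq (swapProg 0) <| .seq (swapProg 1) <| .seq (swapProg 2) <|
      block [.sub 16 9 8]) <|
    .seq playProg <| block [.add 6 7 25, .add 7 7 1]

/-- Plays all rounds by the code between the addresses in registers `3` and `4`, and computes in
register `12` the final rank of the first team. -/
def simulateProg : Program :=
  .seq (block [.const 6 2, .add 7 4 25, .add 8 3 25, .sub 15 4 8]) <|
    .seq (.loop 15 <| .seq roundProg <| block [.sub 15 4 8]) <|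
    .seq (block [.const 10 0]) rankProg

/-- Increments the code, read as a number in base `n`. Register `19` holds the carry. -/
def incrProg : Program :=
  .seq (block [.add 8 3 25, .const 19 1, .sub 15 4 8]) <|
    .seq (.loop 15 <| .seq (block [.load 23 8, .add 23 23 19, .sub 24 1 23]) <|
      .seq (.branch 24 (block [.store 8 23, .const 19 0]) (block [.store 8 25, .const 19 1])) <|
      block [.add 8 8 20, .sub 15 4 8]) <|
    block [.sub 18 20 19]

/-- Computes the parameters. With `l` rounds left, the code for one round has length
`3 * 4096 * l`, which suffices by `canBreak_iff`; register `5` reaches it by doublings. -/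
def setupProg : Program :=
  .seq (block [.const 20 1, .const 21 2, .const 22 4, .const 25 0, .sub 1 0 21, .add 2 0 25,
      .add 3 2 1, .load 16 25, .load 17 20, .add 5 16 16, .add 5 5 5, .add 5 5 5, .add 5 5 5,
      .add 5 5 5, .add 5 5 5, .add 5 5 5, .add 5 5 5, .add 5 5 5, .add 5 5 5, .add 5 5 5,
      .add 5 5 5, .add 14 5 5, .add 5 14 5, .add 4 3 25, .const 0 0, .const 18 1]) <|
    .loop 16 <| block [.add 4 4 5, .sub 16 16 20]

/-- Tries all codes. Register `0` becomes positive when a code is successful. -/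
def breakProg : Program :=
  .seq setupProg <| .seq (.loop 18 <| .seq simulateProg <|
      .seq (block [.sub 14 17 12, .add 0 0 14]) incrProg) <|
    block [.sub 0 20 0, .sub 0 20 0]

/-! ### Correctness of the program -/

/-- From address `a` on, the memory contains the scores `s`. -/
def HasScores {n : ℕ} (m : ℕ → ℕ) (a : ℕ) (s : Fin n → ℕ) : Prop :=
  ∀ i : Fin n, m (a + i) = s i

/-- From address `a` on, the memory contains the first `n` values of `F`. -/
def HasTable (m : ℕ → ℕ) (a n : ℕ) (F : ℕ → ℕ) : Prop :=
  ∀ x < n, m (a + x) = F x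

/-- The memories `m` and `m'` agree below `c`, except between `a` and `b`. -/
def EqOutside (m m' : ℕ → ℕ) (a b c : ℕ) : Prop :=
  ∀ x < c, x < a ∨ b ≤ x → m' x = m x

theorem rank_eq_sum {n : ℕ} (s : Fin n → ℕ) (i : Fin n) (m : ℕ → ℕ) (a : ℕ)
    (hs : HasScores m a s) :
    ∑ l ∈ Finset.range n, (1 - (1 - (m (a + l) + (1 - (1 - (i - l))) - s i))) = rank s i := by
  rw [← Fin.sum_univ_eq_sum_range
    (fun l => 1 - (1 - (m (a + l) + (1 - (1 - (i - l))) - s i))) n, rank, Finset.card_filter]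
  refine Finset.sum_congr rfl fun l _ => ?_
  rw [hs l]
  by_cases h : Before s l i
  · rw [if_pos h]
    unfold Before at h
    omega
  · rw [if_neg h]
    unfold Before at h
    omega

theorem runs_rankProg {n rd : ℕ} {s : Fin n → ℕ} (i : Fin n) {σ : State} (h1 : σ.reg 1 = n)
    (h6 : σ.reg 6 = rd) (h10 : σ.reg 10 = i) (h20 : σ.reg 20 = 1) (hs : HasScores σ.mem rd s) :
    ∃ τ, Runs rankProg (13 * n + 6) σ τ ∧ τ.mem = σ.mem ∧ τ.reg 12 = rank s i ∧
      τ.reg 13 = s i := by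
  have hrun := Runs.block [.add 14 6 10, .load 13 14, .const 11 0, .const 12 0, .sub 28 1 11] σ
  set σ₁ := runAll [.add 14 6 10, .load 13 14, .const 11 0, .const 12 0, .sub 28 1 11] σ with hσ₁
  have h13 : σ₁.reg 13 = s i := by simp [hσ₁, runAll, Op.run, h6, h10, hs i]
  have hm : σ₁.mem = σ.mem := by simp [hσ₁, runAll, Op.run]
  obtain ⟨τ, hloop, -, -, hτm, hτ⟩ := Runs.forLoop (P := block [.add 14 6 11, .load 14 14,
      .sub 23 10 11, .sub 23 20 23, .sub 23 20 23, .add 14 14 23, .sub 14 14 13, .sub 14 20 14,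
      .sub 14 20 14, .add 12 12 14, .add 11 11 20, .sub 28 1 11]) (r := 28) (σ := σ₁)
    (fun j τ => τ.reg 11 = j ∧ τ.reg 28 = n - j ∧ τ.mem = σ.mem ∧ τ.reg 12 =
      ∑ l ∈ Finset.range j, (1 - (1 - (σ.mem (rd + l) + (1 - (1 - (i - l))) - s i))))
    n 12 (by simp [hσ₁, runAll, Op.run, h1])
    (fun j hj τ _ hI => by rw [hI.2.1]; omega)
    (fun j hj τ hf hI => by
      obtain ⟨h11, -, hτm, h12⟩ := hI
      have f1 := hf 1 (by decide)
      have f6 := hf 6 (by decide)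
      have f10 := hf 10 (by decide)
      have f13 := hf 13 (by decide)
      have f20 := hf 20 (by decide)
      simp [hσ₁, runAll, Op.run] at f1 f6 f10 f20
      refine ⟨_, Runs.block _ _, ?_⟩
      simp [runAll, Op.run, f1, f6, f10, f13, f20, h11, h12, h1, h6, h10, h13, h20, hτm,
        Finset.sum_range_succ])
  refine ⟨τ, (hrun.seq hloop).mono (by simp; omega), hτm, ?_, ?_⟩
  · rw [hτ, rank_eq_sum s i _ _ hs]
  · rw [hloop.reg_eq 13 (by decide), h13]

theorem runs_playProg {n rd wr F₀ : ℕ} {s : Fin n → ℕ} {F : ℕ → ℕ} {σ : State}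
    (h1 : σ.reg 1 = n) (h2 : σ.reg 2 = F₀) (h6 : σ.reg 6 = rd) (h7 : σ.reg 7 = wr)
    (h20 : σ.reg 20 = 1) (hs : HasScores σ.mem rd s) (hF : HasTable σ.mem F₀ n F)
    (hrd : rd + n ≤ wr) (hF₀ : F₀ + n ≤ wr) :
    ∃ τ, Runs playProg (n * (13 * n + 14) + 3) σ τ ∧ HasScores τ.mem wr (next s F) ∧
      ∀ x < wr, τ.mem x = σ.mem x := by
  have hrun := Runs.block [.const 10 0, .sub 19 1 10] σ
  set σ₁ := runAll [.const 10 0, .sub 19 1 10] σ with hσ₁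
  obtain ⟨τ, hloop, -, -, hτm, hτ⟩ := Runs.forLoop (P := .seq rankProg <| block [.add 14 2 12,
      .load 14 14, .add 14 13 14, .add 23 7 10, .store 23 14, .add 10 10 20, .sub 19 1 10])
      (r := 19) (σ := σ₁)
    (fun i τ => τ.reg 10 = i ∧ τ.reg 19 = n - i ∧ (∀ x < wr, τ.mem x = σ.mem x) ∧
      ∀ j : Fin n, (j : ℕ) < i → τ.mem (wr + j) = next s F j)
    n (13 * n + 13) (by simp [hσ₁, runAll, Op.run, h1])
    (fun j hj τ _ hI => by rw [hI.2.1]; omega)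
    (fun i hi τ hf hI => by
      obtain ⟨h10, -, hτm, hτ⟩ := hI
      have f1 := hf 1 (by decide)
      have f2 := hf 2 (by decide)
      have f6 := hf 6 (by decide)
      have f7 := hf 7 (by decide)
      have f20 := hf 20 (by decide)
      simp [hσ₁, runAll, Op.run, h1, h2, h6, h7, h20] at f1 f2 f6 f7 f20
      obtain ⟨υ, hυ, hm, h12, h13⟩ := runs_rankProg (s := s) ⟨i, hi⟩ f1 f6 h10 f20
        (fun j => (hτm _ (by have := j.isLt; omega)).trans (hs j))
      have g1 := hυ.reg_eq 1 (by decide)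
      have g2 := hυ.reg_eq 2 (by decide)
      have g7 := hυ.reg_eq 7 (by decide)
      have g10 := hυ.reg_eq 10 (by decide)
      have g20 := hυ.reg_eq 20 (by decide)
      have hr := rank_lt s ⟨i, hi⟩
      have hFr : τ.mem (F₀ + rank s ⟨i, hi⟩) = F (rank s ⟨i, hi⟩) := by
        rw [hτm _ (by omega), hF _ hr]
      refine ⟨_, (hυ.seq (Runs.block _ _)).mono (by simp), ?_⟩
      simp only [runAll, Op.run, Function.update_apply]
      simp [g1, g2, g7, g10, g20, f1, f2, f7, f20, h10, h12, h13, hm, hFr]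
      refine ⟨fun x hx => ?_, fun j hj => ?_⟩
      · rw [if_neg (by omega), hτm x hx]
      · by_cases hji : (j : ℕ) = i
        · subst hji
          simp [next]
        · rw [if_neg hji, hτ j (by omega)])
  exact ⟨τ, (hrun.seq hloop).mono (by simp; linarith), fun j => hτ j j.isLt, hτm⟩

theorem runs_swapProg {N j F₀ c : ℕ} {F : ℕ → ℕ} {σ : State} (hj : j ≤ 2)
    (h2 : σ.reg 2 = F₀) (h3 : σ.reg 3 = F₀ + 4 * N) (h20 : σ.reg 20 = 1) (h22 : σ.reg 22 = 4)
    (hF : HasTable σ.mem F₀ (4 * N) F) :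
    ∃ τ, Runs (swapProg j) (8 * N + 9) σ τ ∧ τ.reg 8 = σ.reg 8 + 1 ∧
      HasTable τ.mem F₀ (4 * N) (swapFrom j (σ.mem (σ.reg 8)) F) ∧
      EqOutside σ.mem τ.mem F₀ (F₀ + 4 * N) c := by
  have hrun := Runs.block [.load 23 8, .add 23 23 23, .add 23 23 23, .add 14 2 23, .const 24 j,
      .add 14 14 24, .add 8 8 20, .sub 19 3 14] σ
  set σ₁ := runAll [.load 23 8, .add 23 23 23, .add 23 23 23, .add 14 2 23, .const 24 j,
      .add 14 14 24, .add 8 8 20, .sub 19 3 14] σ with hσ₁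
  set d := σ.mem (σ.reg 8) with hd
  have hm : σ₁.mem = σ.mem := by simp [hσ₁, runAll, Op.run]
  have h8 : σ₁.reg 8 = σ.reg 8 + 1 := by simp [hσ₁, runAll, Op.run, h20]
  obtain ⟨τ, hloop, -, -, hτ, hτm⟩ := Runs.forLoop (P := block [.add 24 14 20, .load 26 14,
      .load 27 24, .store 14 27, .store 24 26, .add 14 14 22, .sub 19 3 14]) (r := 19) (σ := σ₁)
    -- If `d` exceeds the number of matches, the loop is not entered.
    (fun u τ => τ.reg 14 = F₀ + 4 * (d + u) + j ∧
      τ.reg 19 = F₀ + 4 * N - (F₀ + 4 * (d + u) + j) ∧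
      (∀ x < 4 * N, τ.mem (F₀ + x) =
        if d ≤ x / 4 ∧ x / 4 < d + u then F (swapMod j x) else F x) ∧
      ∀ x, x < F₀ ∨ F₀ + 4 * N ≤ x → τ.mem x = σ.mem x)
    (N - d) 7 (by
      refine ⟨?_, ?_, fun x hx => ?_, fun x _ => by rw [hm]⟩
      · simp [hσ₁, runAll, Op.run, h2, ← hd]
        omega
      · simp [hσ₁, runAll, Op.run, h2, h3, ← hd]
        omega
      · rw [hm, hF x hx, if_neg (by omega)])
    (fun u hu τ _ hI => by rw [hI.2.1]; omega)
    (fun u hu τ hf hI => by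
      obtain ⟨h14, -, hτ, hτm⟩ := hI
      have f3 := hf 3 (by decide)
      have f20 := hf 20 (by decide)
      have f22 := hf 22 (by decide)
      simp [hσ₁, runAll, Op.run, h3, h20, h22] at f3 f20 f22
      refine ⟨_, Runs.block _ _, ?_⟩
      have e₁ := hτ (4 * (d + u) + j) (by omega)
      have e₂ := hτ (4 * (d + u) + j + 1) (by omega)
      rw [if_neg (by omega), ← add_assoc, ← add_assoc] at e₂
      rw [if_neg (by omega), ← add_assoc] at e₁
      simp only [runAll, Op.run, Function.update_apply]
      simp [f3, f20, f22, h14, e₁, e₂]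
      refine ⟨by ring, by congr 1; ring, fun x hx => ?_, fun x hx => ?_⟩
      · by_cases hx₁ : x = 4 * (d + u) + j + 1
        · rw [if_pos (by omega), if_pos (by omega)]
          congr 1
          rw [swapMod, if_neg (by omega), if_pos (by omega)]
          omega
        by_cases hx₂ : x = 4 * (d + u) + j
        · rw [if_neg (by omega), if_pos (by omega), if_pos (by omega)]
          congr 1
          rw [swapMod, if_pos (by omega)]
          omega
        rw [if_neg (by omega), if_neg (by omega), hτ x hx]
        by_cases hxu : x / 4 = d + u
        · rw [if_neg (by omega), if_pos (by omega), swapMod, if_neg (by omega), if_neg (by omega)]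
        · congr 1
          simp only [eq_iff_iff]
          omega
      · rw [if_neg (by omega), if_neg (by omega), hτm x hx])
  refine ⟨τ, (hrun.seq hloop).mono (by simp; omega), ?_, fun x hx => ?_, fun x _ => hτm x⟩
  · rw [hloop.reg_eq 8 (by simp [block, Program.writes, Op.writes]), h8]
  · rw [hτ x hx, swapFrom]
    congr 1
    simp only [eq_iff_iff]
    omega

theorem runs_initProg {N F₀ c : ℕ} {σ : State}
    (h2 : σ.reg 2 = F₀) (h3 : σ.reg 3 = F₀ + 4 * N) (h20 : σ.reg 20 = 1) (h21 : σ.reg 21 = 2)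
    (h25 : σ.reg 25 = 0) :
    ∃ τ, Runs initProg (11 * N + 3) σ τ ∧ HasTable τ.mem F₀ (4 * N) (fun x => x % 4) ∧
      EqOutside σ.mem τ.mem F₀ (F₀ + 4 * N) c := by
  have hrun := Runs.block [.add 14 2 25, .sub 19 3 14] σ
  set σ₁ := runAll [.add 14 2 25, .sub 19 3 14] σ with hσ₁
  obtain ⟨τ, hloop, -, -, hτ, hτm⟩ := Runs.forLoop (P := block [.store 14 25, .add 14 14 20,
      .store 14 20, .add 14 14 20, .store 14 21, .add 14 14 20, .const 24 3, .store 14 24,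
      .add 14 14 20, .sub 19 3 14]) (r := 19) (σ := σ₁)
    (fun u τ => τ.reg 14 = F₀ + 4 * u ∧ τ.reg 19 = F₀ + 4 * N - (F₀ + 4 * u) ∧
      (∀ x < 4 * u, τ.mem (F₀ + x) = x % 4) ∧
      ∀ x, x < F₀ ∨ F₀ + 4 * N ≤ x → τ.mem x = σ.mem x)
    N 10 (by simp [hσ₁, runAll, Op.run, h2, h3, h25])
    (fun u hu τ _ hI => by rw [hI.2.1]; omega)
    (fun u hu τ hf hI => by
      obtain ⟨h14, -, hτ, hτm⟩ := hI
      have f3 := hf 3 (by decide)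
      have f20 := hf 20 (by decide)
      have f21 := hf 21 (by decide)
      have f25 := hf 25 (by decide)
      simp [hσ₁, runAll, Op.run, h3, h20, h21, h25] at f3 f20 f21 f25
      refine ⟨_, Runs.block _ _, ?_⟩
      simp only [runAll, Op.run, Function.update_apply]
      simp [f3, f20, f21, f25, h14]
      refine ⟨by ring, by congr 1, fun x hx => ?_, fun x hx => ?_⟩
      · split_ifs
        · omega
        · omega
        · omega
        · omega
        · exact hτ x (by omega)
      · rw [if_neg (by omega), if_neg (by omega), if_neg (by omega), if_neg (by omega), hτm x hx])
  exact ⟨τ, (hrun.seq hloop).mono (by simp; omega), fun x hx => hτ x hx, fun x _ => hτm x⟩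

/-- The conditions on the addresses say that the code, the current scores and the scores after the
round are kept apart from the table of points and from each other. -/
theorem runs_roundProg {N q rd wr F₀ : ℕ} {s : Fin (4 * N) → ℕ} {σ : State}
    (h1 : σ.reg 1 = 4 * N) (h2 : σ.reg 2 = F₀) (h3 : σ.reg 3 = F₀ + 4 * N)
    (h5 : σ.reg 5 = 3 * q) (h6 : σ.reg 6 = rd) (h7 : σ.reg 7 = wr) (h20 : σ.reg 20 = 1)
    (h21 : σ.reg 21 = 2) (h22 : σ.reg 22 = 4) (h25 : σ.reg 25 = 0) (hs : HasScores σ.mem rd s)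
    (hptr : F₀ + 4 * N ≤ σ.reg 8) (hwr : σ.reg 8 + 3 * q ≤ wr) (hrd : rd + 4 * N ≤ wr)
    (hrdF : rd + 4 * N ≤ F₀ ∨ F₀ + 4 * N ≤ rd) :
    ∃ τ, Runs roundProg (11 * N + q * (24 * N + 29) + 4 * N * (52 * N + 14) + 11) σ τ ∧
      τ.reg 6 = wr ∧ τ.reg 7 = wr + 4 * N ∧ τ.reg 8 = σ.reg 8 + 3 * q ∧
      HasScores τ.mem wr (next s (table (fun x => σ.mem (σ.reg 8 + x)) q)) ∧
      EqOutside σ.mem τ.mem F₀ (F₀ + 4 * N) wr := by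
  set g : ℕ → ℕ := fun x => σ.mem (σ.reg 8 + x) with hg
  obtain ⟨σ₁, hrun₁, hF₁, hm₁⟩ := runs_initProg (c := wr) h2 h3 h20 h21 h25
  have hrun₂ := Runs.block [.add 9 8 5, .sub 16 9 8] σ₁
  set σ₂ := runAll [.add 9 8 5, .sub 16 9 8] σ₁ with hσ₂
  have e₂ (r : ℕ) (hr : r ∉ initProg.writes) (hr9 : r ≠ 9) (hr16 : r ≠ 16) :
      σ₂.reg r = σ.reg r := by
    rw [← hrun₁.reg_eq r hr]
    simp [hσ₂, runAll, Op.run, hr9, hr16]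
  have a5 : σ₁.reg 5 = 3 * q := (hrun₁.reg_eq 5 (by decide)).trans h5
  have a8 : σ₁.reg 8 = σ.reg 8 := hrun₁.reg_eq 8 (by decide)
  have m₂ : σ₂.mem = σ₁.mem := by simp [hσ₂, runAll, Op.run]
  obtain ⟨σ₃, hrun₃, b8, -, hF₃, hm₃⟩ := Runs.forLoop (P := .seq (swapProg 0) <|
      .seq (swapProg 1) <| .seq (swapProg 2) <| block [.sub 16 9 8]) (r := 16) (σ := σ₂)
    (fun u τ => τ.reg 8 = σ.reg 8 + 3 * u ∧ τ.reg 16 = 3 * (q - u) ∧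
      HasTable τ.mem F₀ (4 * N) (table g u) ∧ EqOutside σ.mem τ.mem F₀ (F₀ + 4 * N) wr)
    q (24 * N + 28) (by
      rw [m₂]
      refine ⟨e₂ 8 (by decide) (by decide) (by decide), ?_, hF₁, hm₁⟩
      simp [hσ₂, runAll, Op.run, a5])
    (fun u hu τ _ hI => by rw [hI.2.1]; omega)
    (fun u hu τ hf hI => by
      obtain ⟨c8, -, hF, hm⟩ := hI
      have f (r : ℕ) (hr : r ∉ roundProg.writes) : τ.reg r = σ.reg r := by
        simp only [roundProg, Program.writes, List.mem_append, not_or] at hr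
        obtain ⟨hi, hb, ⟨hs₀, hs₁, hs₂, hc⟩, -⟩ := hr
        simp only [block, Program.writes, Op.writes, List.append_nil, List.mem_append,
          List.mem_singleton, not_or] at hb
        rw [hf r (by
            simp only [Program.writes, List.mem_append, not_or]
            exact ⟨hs₀, hs₁, hs₂, hc⟩),
          e₂ r hi hb.1 hb.2]
      have f2 := (f 2 (by decide)).trans h2
      have f3 := (f 3 (by decide)).trans h3
      have f20 := (f 20 (by decide)).trans h20
      have f22 := (f 22 (by decide)).trans h22
      have f9 : τ.reg 9 = σ.reg 8 + 3 * q := by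
        rw [hf 9 (by decide)]
        simp [hσ₂, runAll, Op.run, a5, a8]
      obtain ⟨τ₁, r₁, p₁, t₁, o₁⟩ := runs_swapProg (c := wr) (by norm_num : 0 ≤ 2) f2 f3 f20 f22 hF
      obtain ⟨τ₂, r₂, p₂, t₂, o₂⟩ := runs_swapProg (c := wr) (by norm_num : 1 ≤ 2)
        ((r₁.reg_eq 2 (by decide)).trans f2) ((r₁.reg_eq 3 (by decide)).trans f3)
        ((r₁.reg_eq 20 (by decide)).trans f20) ((r₁.reg_eq 22 (by decide)).trans f22) t₁
      obtain ⟨τ₃, r₃, p₃, t₃, o₃⟩ := runs_swapProg (c := wr) (by norm_num : 2 ≤ 2)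
        ((r₂.reg_eq 2 (by decide)).trans ((r₁.reg_eq 2 (by decide)).trans f2))
        ((r₂.reg_eq 3 (by decide)).trans ((r₁.reg_eq 3 (by decide)).trans f3))
        ((r₂.reg_eq 20 (by decide)).trans ((r₁.reg_eq 20 (by decide)).trans f20))
        ((r₂.reg_eq 22 (by decide)).trans ((r₁.reg_eq 22 (by decide)).trans f22)) t₂
      have d₁ : τ.mem (τ.reg 8) = g (3 * u) := by
        rw [c8, hm _ (by omega) (by omega)]
      have d₂ : τ₁.mem (τ₁.reg 8) = g (3 * u + 1) := by
        rw [p₁, c8, o₁ _ (by omega) (by omega), hm _ (by omega) (by omega), add_assoc]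
      have d₃ : τ₂.mem (τ₂.reg 8) = g (3 * u + 2) := by
        rw [p₂, p₁, c8, o₂ _ (by omega) (by omega), o₁ _ (by omega) (by omega),
          hm _ (by omega) (by omega), add_assoc, add_assoc]
      rw [d₁, d₂, d₃] at t₃
      have g9 : τ₃.reg 9 = σ.reg 8 + 3 * q := by
        rw [r₃.reg_eq 9 (by decide), r₂.reg_eq 9 (by decide), r₁.reg_eq 9 (by decide), f9]
      refine ⟨_, (r₁.seq (r₂.seq (r₃.seq (Runs.block _ _)))).mono (by simp; omega), ?_, ?_, ?_⟩
      · simp [runAll, Op.run, p₃, p₂, p₁, c8]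
        ring
      · simp [runAll, Op.run, p₃, p₂, p₁, c8, g9]
        omega
      · simp only [runAll, Op.run]
        refine ⟨t₃, fun x hx hx' => ?_⟩
        rw [o₃ x hx hx', o₂ x hx hx', o₁ x hx hx', hm x hx hx'])
  have e₃ (r : ℕ) (hr : r ∉ roundProg.writes) : σ₃.reg r = σ.reg r := by
    simp only [roundProg, Program.writes, List.mem_append, not_or] at hr
    obtain ⟨hi, hb, ⟨hs₀, hs₁, hs₂, hc⟩, -⟩ := hr
    simp only [block, Program.writes, Op.writes, List.append_nil, List.mem_append,
      List.mem_singleton, not_or] at hb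
    rw [hrun₃.reg_eq r (by
        simp only [Program.writes, List.mem_append, not_or]
        exact ⟨hs₀, hs₁, hs₂, hc⟩),
      e₂ r hi hb.1 hb.2]
  have e₃6 : σ₃.reg 6 = rd := by
    rw [hrun₃.reg_eq 6 (by decide), e₂ 6 (by decide) (by decide) (by decide), h6]
  have e₃7 : σ₃.reg 7 = wr := by
    rw [hrun₃.reg_eq 7 (by decide), e₂ 7 (by decide) (by decide) (by decide), h7]
  obtain ⟨σ₄, hrun₄, hs₄, hm₄⟩ := runs_playProg ((e₃ 1 (by decide)).trans h1)
    ((e₃ 2 (by decide)).trans h2) e₃6 e₃7 ((e₃ 20 (by decide)).trans h20)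
    (fun i => (hm₃ _ (by omega) (by omega)).trans (hs i)) hF₃ hrd (by omega)
  have g7 := (hrun₄.reg_eq 7 (by decide)).trans e₃7
  have g1 := (hrun₄.reg_eq 1 (by decide)).trans ((e₃ 1 (by decide)).trans h1)
  have g25 := (hrun₄.reg_eq 25 (by decide)).trans ((e₃ 25 (by decide)).trans h25)
  have g8 := (hrun₄.reg_eq 8 (by decide)).trans b8
  refine ⟨_, (hrun₁.seq (hrun₂.seq (hrun₃.seq (hrun₄.seq (Runs.block _ _))))).mono ?_,
    ?_, ?_, ?_, ?_, ?_⟩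
  · simp only [List.length_cons, List.length_nil]
    ring_nf
    omega
  · simp [runAll, Op.run, g7, g25]
  · simp [runAll, Op.run, g7, g1]
  · simp [runAll, Op.run, g8]
  · exact hs₄
  · intro x hx hx'
    exact (hm₄ x hx).trans (hm₃ x hx hx')

/-- A bound for the number of steps in which the program plays by one code. -/
def simulateTime (N q l : ℕ) : ℕ :=
  l * (11 * N + q * (24 * N + 29) + 4 * N * (52 * N + 14) + 14) + 52 * N + 12

theorem runs_simulateProg {N q l : ℕ} (hN : 0 < N) (hq : l ≠ 0 → 0 < q) {s : Fin (4 * N) → ℕ}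
    {σ : State} (h1 : σ.reg 1 = 4 * N) (h2 : σ.reg 2 = 4 * N + 2)
    (h3 : σ.reg 3 = 4 * N + 2 + 4 * N) (h4 : σ.reg 4 = 4 * N + 2 + 4 * N + 3 * q * l)
    (h5 : σ.reg 5 = 3 * q) (h20 : σ.reg 20 = 1) (h21 : σ.reg 21 = 2) (h22 : σ.reg 22 = 4)
    (h25 : σ.reg 25 = 0) (hs : HasScores σ.mem 2 s) :
    ∃ τ, Runs simulateProg (simulateTime N q l) σ τ ∧
      τ.reg 12 = rank (scoreAfter q (fun x => σ.mem (4 * N + 2 + 4 * N + x)) s l)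
        ⟨0, by omega⟩ ∧
      EqOutside σ.mem τ.mem (4 * N + 2) (4 * N + 2 + 4 * N)
        (4 * N + 2 + 4 * N + 3 * q * l) := by
  set D := 4 * N + 2 + 4 * N with hD
  set g : ℕ → ℕ := fun x => σ.mem (D + x) with hg
  have hrun₁ := Runs.block [.const 6 2, .add 7 4 25, .add 8 3 25, .sub 15 4 8] σ
  set σ₁ := runAll [.const 6 2, .add 7 4 25, .add 8 3 25, .sub 15 4 8] σ with hσ₁
  obtain ⟨σ₂, hrun₂, ⟨rd, wr, a6, -, -, -, -, hs₂⟩, -, -, hm₂⟩ := Runs.forLoop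
      (P := .seq roundProg <| block [.sub 15 4 8]) (r := 15) (σ := σ₁)
    -- The scores after each round are written behind those before it, and the first scores are part
    -- of the input.
    (fun r τ => (∃ rd wr, τ.reg 6 = rd ∧ τ.reg 7 = wr ∧ rd + 4 * N ≤ wr ∧
        (rd + 4 * N ≤ 4 * N + 2 ∨ D ≤ rd) ∧ D + 3 * q * l ≤ wr ∧
        HasScores τ.mem rd (scoreAfter q g s r)) ∧
      τ.reg 8 = D + 3 * q * r ∧ τ.reg 15 = 3 * q * (l - r) ∧
      EqOutside σ.mem τ.mem (4 * N + 2) D (D + 3 * q * l))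
    l (11 * N + q * (24 * N + 29) + 4 * N * (52 * N + 14) + 12) (by
      refine ⟨⟨2, D + 3 * q * l, ?_⟩, ?_⟩
      · simp [hσ₁, runAll, Op.run, h4, h25, scoreAfter, hs]
        omega
      · simp [hσ₁, runAll, Op.run, h3, h4, h25, EqOutside])
    (fun r hr τ _ hI => by
      rw [hI.2.2.1, Nat.mul_eq_zero]
      have := fun h => (hq h).ne'
      omega)
    (fun r hr τ hf hI => by
      obtain ⟨⟨rd, wr, b6, b7, hrw, hrF, hwr, hsc⟩, b8, -, hm⟩ := hI
      have f (x : ℕ) (hx : x ∉ simulateProg.writes) : τ.reg x = σ.reg x := by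
        simp only [simulateProg, Program.writes, List.mem_append, not_or] at hx
        obtain ⟨ha, hb, -⟩ := hx
        simp only [block, Program.writes, Op.writes, List.append_nil, List.mem_append,
          List.mem_singleton, not_or] at ha
        rw [hf x (by simpa only [Program.writes, List.mem_append, not_or] using hb)]
        simp [hσ₁, runAll, Op.run, ha]
      have hle : 3 * q * r + 3 * q ≤ 3 * q * l := by
        rw [← Nat.mul_succ]
        exact Nat.mul_le_mul_left _ hr
      obtain ⟨υ, hυ, c6, c7, c8, hsυ, hmυ⟩ := runs_roundProg ((f 1 (by decide)).trans h1)
        ((f 2 (by decide)).trans h2) ((f 3 (by decide)).trans h3) ((f 5 (by decide)).trans h5)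
        b6 b7 ((f 20 (by decide)).trans h20) ((f 21 (by decide)).trans h21)
        ((f 22 (by decide)).trans h22) ((f 25 (by decide)).trans h25) hsc (by omega) (by omega)
        hrw hrF
      have c4 := (hυ.reg_eq 4 (by decide)).trans ((f 4 (by decide)).trans h4)
      have htab : table (fun x => τ.mem (τ.reg 8 + x)) q =
          table (fun x => g (3 * q * r + x)) q :=
        table_congr fun x hx => by
          rw [b8, hm _ (by omega) (by omega), add_assoc]
      rw [htab] at hsυ
      refine ⟨_, (hυ.seq (Runs.block _ _)).mono (by simp), ⟨wr, wr + 4 * N, ?_⟩, ?_, ?_, ?_⟩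
      · simp only [runAll, Op.run, Function.update_apply]
        simp [c6, c7]
        exact ⟨by omega, by omega, hsυ⟩
      · simp [runAll, Op.run, c8, b8]
        ring
      · simp only [runAll, Op.run, Function.update_apply]
        simp [c8, b8, c4]
        rw [Nat.mul_sub, Nat.mul_add, mul_one]
        omega
      · intro x hx hx'
        exact (hmυ x (by omega) hx').trans (hm x hx hx'))
  have f₂ (x : ℕ) (hx : x ∉ simulateProg.writes) : σ₂.reg x = σ.reg x := by
    simp only [simulateProg, Program.writes, List.mem_append, not_or] at hx
    obtain ⟨ha, hb, -⟩ := hx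
    simp only [block, Program.writes, Op.writes, List.append_nil, List.mem_append,
      List.mem_singleton, not_or] at ha
    rw [hrun₂.reg_eq x (by simpa only [Program.writes, List.mem_append, not_or] using hb)]
    simp [hσ₁, runAll, Op.run, ha]
  have hrun₃ := Runs.block [.const 10 0] σ₂
  set σ₃ := runAll [.const 10 0] σ₂ with hσ₃
  have m₃ : σ₃.mem = σ₂.mem := by simp [hσ₃, runAll, Op.run]
  obtain ⟨σ₄, hrun₄, m₄, h12, -⟩ := runs_rankProg (σ := σ₃) (rd := rd)
    (s := scoreAfter q g s l) ⟨0, by omega⟩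
    (by simp [hσ₃, runAll, Op.run, f₂ 1 (by decide), h1])
    (by simp [hσ₃, runAll, Op.run, a6])
    (by simp [hσ₃, runAll, Op.run])
    (by simp [hσ₃, runAll, Op.run, f₂ 20 (by decide), h20])
    (by rw [m₃]; exact hs₂)
  refine ⟨σ₄, (hrun₁.seq (hrun₂.seq (hrun₃.seq hrun₄))).mono ?_, h12, ?_⟩
  · simp only [List.length_cons, List.length_nil, simulateTime]
    ring_nf
    omega
  · rw [m₄, m₃]
    exact hm₂

/-- The lowest digit of `A` and the carry `c` overflow, or they form the lowest digit of `A + c`. -/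
theorem carry_step {n A c : ℕ} (hn : 0 < n) (hc : c ≤ 1) :
    (n - (A % n + c) ≠ 0 → (A + c) % n = A % n + c ∧ (A + c) / n = A / n) ∧
    (n - (A % n + c) = 0 → (A + c) % n = 0 ∧ (A + c) / n = A / n + 1) := by
  have h₁ := Nat.mod_lt A hn
  have h₂ : A + c = A % n + c + n * (A / n) := by
    have := Nat.mod_add_div A n
    omega
  constructor <;> intro h
  · rw [h₂, Nat.add_mul_mod_self_left, Nat.add_mul_div_left _ _ hn, Nat.mod_eq_of_lt (by omega),
      Nat.div_eq_of_lt (by omega)]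
    simp
  · have h₃ : A % n + c = n := by omega
    rw [h₂, h₃, Nat.add_mul_mod_self_left, Nat.add_mul_div_left _ _ hn, Nat.mod_self,
      Nat.div_self hn]
    omega

theorem runs_incrProg {n K D v : ℕ} (hn : 0 < n) (hv : v < n ^ K) {σ : State}
    (h1 : σ.reg 1 = n) (h3 : σ.reg 3 = D) (h4 : σ.reg 4 = D + K) (h20 : σ.reg 20 = 1)
    (h25 : σ.reg 25 = 0) (hd : ∀ x < K, σ.mem (D + x) = v / n ^ x % n) :
    ∃ τ, Runs incrProg (9 * K + 5) σ τ ∧ (τ.reg 18 = 0 ↔ v + 1 = n ^ K) ∧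
      (∀ x < K, τ.mem (D + x) = (v + 1) / n ^ x % n) ∧ ∀ x < D, τ.mem x = σ.mem x := by
  have hrun₁ := Runs.block [.add 8 3 25, .const 19 1, .sub 15 4 8] σ
  set σ₁ := runAll [.add 8 3 25, .const 19 1, .sub 15 4 8] σ with hσ₁
  obtain ⟨σ₂, hrun₂, -, -, hc, h19, hd₂, -, hm₂⟩ := Runs.forLoop
      (P := .seq (block [.load 23 8, .add 23 23 19, .sub 24 1 23]) <|
      .seq (.branch 24 (block [.store 8 23, .const 19 0]) (block [.store 8 25, .const 19 1])) <|
      block [.add 8 8 20, .sub 15 4 8]) (r := 15) (σ := σ₁)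
    -- The digits of `v + 1` below `y` are in place, and register `19` holds the carry to digit `y`.
    (fun y τ => τ.reg 8 = D + y ∧ τ.reg 15 = K - y ∧ τ.reg 19 ≤ 1 ∧
      (v + 1) / n ^ y = v / n ^ y + τ.reg 19 ∧
      (∀ x < y, τ.mem (D + x) = (v + 1) / n ^ x % n) ∧
      (∀ x < K, y ≤ x → τ.mem (D + x) = v / n ^ x % n) ∧ ∀ x < D, τ.mem x = σ.mem x)
    K 8 (by
      simp [hσ₁, runAll, Op.run, h3, h4, h25]
      exact hd)
    (fun y hy τ _ hI => by rw [hI.2.1]; omega)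
    (fun y hy τ hf hI => by
      obtain ⟨b8, -, hc, b19, hlo, hhi, hm⟩ := hI
      have f1 := hf 1 (by decide)
      have f4 := hf 4 (by decide)
      have f20 := hf 20 (by decide)
      have f25 := hf 25 (by decide)
      simp [hσ₁, runAll, Op.run, h1, h4, h20, h25] at f1 f4 f20 f25
      have hdig := hhi y hy le_rfl
      obtain ⟨s₁, s₂⟩ := carry_step (A := v / n ^ y) hn hc
      rw [← b19, Nat.div_div_eq_div_mul, Nat.div_div_eq_div_mul, ← pow_succ] at s₁ s₂
      have r₁ := Runs.block [.load 23 8, .add 23 23 19, .sub 24 1 23] τ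
      set τ₁ := runAll [.load 23 8, .add 23 23 19, .sub 24 1 23] τ with hτ₁
      have t24 : τ₁.reg 24 = n - (v / n ^ y % n + τ.reg 19) := by
        simp [hτ₁, runAll, Op.run, b8, hdig, f1]
      by_cases h24 : τ₁.reg 24 = 0
      · obtain ⟨hmod, hdiv⟩ := s₂ (t24 ▸ h24)
        have r₂ := Runs.branchFalse (P := block [.store 8 23, .const 19 0]) h24
          (Runs.block [.store 8 25, .const 19 1] τ₁)
        refine ⟨_, (r₁.seq (r₂.seq (Runs.block _ _))).mono (by simp), ?_⟩
        simp only [hτ₁, runAll, Op.run, Function.update_apply]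
        simp [b8, f4, f20, f25, hdiv]
        refine ⟨by ring, by omega, fun x hx => ?_, fun x hx hx' => ?_, fun x hx => ?_⟩
        · by_cases hxy : x = y
          · rw [if_pos hxy, hxy, hmod]
          · rw [if_neg hxy, hlo x (by omega)]
        · rw [if_neg (by omega), hhi x hx (by omega)]
        · rw [if_neg (by omega), hm x hx]
      · obtain ⟨hmod, hdiv⟩ := s₁ (t24 ▸ h24)
        have r₂ := Runs.branchTrue (Q := block [.store 8 25, .const 19 1]) h24
          (Runs.block [.store 8 23, .const 19 0] τ₁)
        refine ⟨_, (r₁.seq (r₂.seq (Runs.block _ _))).mono (by simp), ?_⟩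
        simp only [hτ₁, runAll, Op.run, Function.update_apply]
        simp [b8, f4, f20, hdiv, hdig]
        refine ⟨by ring, by omega, fun x hx => ?_, fun x hx hx' => ?_, fun x hx => ?_⟩
        · by_cases hxy : x = y
          · rw [if_pos hxy, hxy, hmod]
          · rw [if_neg hxy, hlo x (by omega)]
        · rw [if_neg (by omega), hhi x hx (by omega)]
        · rw [if_neg (by omega), hm x hx])
  have h20' : σ₂.reg 20 = 1 := by
    rw [hrun₂.reg_eq 20 (by decide)]
    simp [hσ₁, runAll, Op.run, h20]
  refine ⟨_, (hrun₁.seq (hrun₂.seq (Runs.block _ _))).mono (by simp; omega), ?_, ?_, ?_⟩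
  · simp [runAll, Op.run, h20']
    rw [Nat.div_eq_of_lt hv, zero_add] at h19
    rw [← h19, Nat.sub_eq_zero_iff_le, Nat.one_le_div_iff (by positivity)]
    omega
  · simpa [runAll, Op.run] using hd₂
  · simpa [runAll, Op.run] using hm₂

theorem runs_setupProg {n l b : ℕ} {σ : State} (h0 : σ.reg 0 = n + 2) (hl : σ.mem 0 = l)
    (hb : σ.mem 1 = b) :
    ∃ τ, Runs setupProg (3 * l + 27) σ τ ∧ τ.mem = σ.mem ∧ τ.reg 0 = 0 ∧ τ.reg 1 = n ∧
      τ.reg 2 = n + 2 ∧ τ.reg 3 = n + 2 + n ∧ τ.reg 4 = n + 2 + n + 3 * (4096 * l) * l ∧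
      τ.reg 5 = 3 * (4096 * l) ∧ τ.reg 17 = b ∧ τ.reg 18 = 1 ∧ τ.reg 20 = 1 ∧ τ.reg 21 = 2 ∧
      τ.reg 22 = 4 ∧ τ.reg 25 = 0 := by
  have hrun := Runs.block [.const 20 1, .const 21 2, .const 22 4, .const 25 0, .sub 1 0 21,
      .add 2 0 25, .add 3 2 1, .load 16 25, .load 17 20, .add 5 16 16, .add 5 5 5, .add 5 5 5,
      .add 5 5 5, .add 5 5 5, .add 5 5 5, .add 5 5 5, .add 5 5 5, .add 5 5 5, .add 5 5 5,
      .add 5 5 5, .add 5 5 5, .add 14 5 5, .add 5 14 5, .add 4 3 25, .const 0 0, .const 18 1] σ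
  set σ₁ := runAll [.const 20 1, .const 21 2, .const 22 4, .const 25 0, .sub 1 0 21,
      .add 2 0 25, .add 3 2 1, .load 16 25, .load 17 20, .add 5 16 16, .add 5 5 5, .add 5 5 5,
      .add 5 5 5, .add 5 5 5, .add 5 5 5, .add 5 5 5, .add 5 5 5, .add 5 5 5, .add 5 5 5,
      .add 5 5 5, .add 5 5 5, .add 14 5 5, .add 5 14 5, .add 4 3 25, .const 0 0, .const 18 1] σ
    with hσ₁
  have h5 : σ₁.reg 5 = 3 * (4096 * l) := by
    simp [hσ₁, runAll, Op.run, hl]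
    ring
  obtain ⟨τ, hloop, h4, -, hm⟩ := Runs.forLoop (P := block [.add 4 4 5, .sub 16 16 20]) (r := 16)
    (σ := σ₁)
    (fun i τ => τ.reg 4 = n + 2 + n + 3 * (4096 * l) * i ∧ τ.reg 16 = l - i ∧ τ.mem = σ.mem)
    l 2 (by simp [hσ₁, runAll, Op.run, h0, hl])
    (fun i hi τ _ hI => by rw [hI.2.1]; omega)
    (fun i hi τ hf hI => by
      obtain ⟨h4, h16, hm⟩ := hI
      have f5 := (hf 5 (by decide)).trans h5
      have f20 := hf 20 (by decide)
      simp [hσ₁, runAll, Op.run] at f20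
      refine ⟨_, Runs.block _ _, ?_⟩
      simp [runAll, Op.run, f5, f20, h4, h16, hm]
      exact ⟨by ring, by omega⟩)
  refine ⟨τ, (hrun.seq hloop).mono (by simp; omega), hm, ?_, ?_, ?_, ?_, h4, ?_, ?_, ?_, ?_, ?_,
    ?_, ?_⟩
  · rw [hloop.reg_eq 0 (by decide)]
    simp [hσ₁, runAll, Op.run]
  · rw [hloop.reg_eq 1 (by decide)]
    simp [hσ₁, runAll, Op.run, h0]
  · rw [hloop.reg_eq 2 (by decide)]
    simp [hσ₁, runAll, Op.run, h0]
  · rw [hloop.reg_eq 3 (by decide)]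
    simp [hσ₁, runAll, Op.run, h0]
  · rw [hloop.reg_eq 5 (by decide), h5]
  · rw [hloop.reg_eq 17 (by decide)]
    simp [hσ₁, runAll, Op.run, hb]
  · rw [hloop.reg_eq 18 (by decide)]
    simp [hσ₁, runAll, Op.run]
  · rw [hloop.reg_eq 20 (by decide)]
    simp [hσ₁, runAll, Op.run]
  · rw [hloop.reg_eq 21 (by decide)]
    simp [hσ₁, runAll, Op.run]
  · rw [hloop.reg_eq 22 (by decide)]
    simp [hσ₁, runAll, Op.run]
  · rw [hloop.reg_eq 25 (by decide)]
    simp [hσ₁, runAll, Op.run]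

/-- A bound for the number of steps of the program. -/
def breakTime (N l : ℕ) : ℕ :=
  (4 * N) ^ (3 * (4096 * l) * l) * (simulateTime N (4096 * l) l + 9 * (3 * (4096 * l) * l) + 8) +
    3 * l + 30

theorem rank_eq_card {n : ℕ} (s : Fin n → ℕ) (h : 0 < n) :
    rank s ⟨0, h⟩ = (Finset.univ.filter fun j => s ⟨0, h⟩ < s j).card := by
  unfold rank
  congr 1
  refine Finset.filter_congr fun j _ => ?_
  simp [Before, Fin.lt_def]

theorem exists_digits {n K : ℕ} {g : ℕ → ℕ} (hg : ∀ x, g x < n) :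
    ∃ v < n ^ K, ∀ x < K, v / n ^ x % n = g x := by
  refine ⟨finFunctionFinEquiv fun i : Fin K => (⟨g i, hg i⟩ : Fin n), Fin.isLt _, fun x hx => ?_⟩
  have h := congrFun (finFunctionFinEquiv.symm_apply_apply
    fun i : Fin K => (⟨g i, hg i⟩ : Fin n)) ⟨x, hx⟩
  exact congrArg Fin.val h

/-- The program answers correctly. After `v` iterations of the main loop, the codes of the numbers
less than `v` have been tried and the memory contains the code of `v`. -/
theorem runs_breakProg {N l b : ℕ} (hN : 0 < 4 * N) {s : Fin (4 * N) → ℕ} {σ : State}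
    (h0 : σ.reg 0 = 4 * N + 2) (hl : σ.mem 0 = l) (hb : σ.mem 1 = b) (hs : HasScores σ.mem 2 s)
    (hz : ∀ x, 4 * N + 2 ≤ x → σ.mem x = 0) :
    ∃ τ, Runs breakProg (breakTime N l) σ τ ∧
      (CanBreak ⟨0, hN⟩ b l s → τ.reg 0 = 1) ∧ (¬ CanBreak ⟨0, hN⟩ b l s → τ.reg 0 = 0) := by
  set K := 3 * (4096 * l) * l with hK
  set D := 4 * N + 2 + 4 * N with hD
  let succeeds : ℕ → Prop := fun v =>
    rank (scoreAfter (4096 * l) (fun x => v / (4 * N) ^ x % (4 * N)) s l) ⟨0, hN⟩ < b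
  obtain ⟨σ₁, hrun₁, m₁, i0, i1, i2, i3, i4, i5, i17, i18, i20, i21, i22, i25⟩ :=
    runs_setupProg h0 hl hb
  obtain ⟨σ₂, hrun₂, a0, -⟩ := Runs.forLoop
      (P := .seq simulateProg <| .seq (block [.sub 14 17 12, .add 0 0 14]) incrProg) (r := 18)
      (σ := σ₁)
    (fun v τ => (τ.reg 0 ≠ 0 ↔ ∃ u < v, succeeds u) ∧ (τ.reg 18 = 0 ↔ v = (4 * N) ^ K) ∧
      (∀ x < K, τ.mem (D + x) = v / (4 * N) ^ x % (4 * N)) ∧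
      ∀ x < 4 * N + 2, τ.mem x = σ.mem x)
    ((4 * N) ^ K) (simulateTime N (4096 * l) l + 9 * K + 7) (by
      refine ⟨by simp [i0], ?_, fun x hx => ?_, fun x _ => by rw [m₁]⟩
      · have : 0 < (4 * N) ^ K := by positivity
        simp only [i18]
        omega
      · rw [m₁, hz _ (by omega)]
        simp)
    (fun v hv τ _ hI => hI.2.1)
    (fun v hv τ hf hI => by
      obtain ⟨c0, -, hd, hm⟩ := hI
      have f1 := (hf 1 (by decide)).trans i1
      have f2 := (hf 2 (by decide)).trans i2
      have f3 := (hf 3 (by decide)).trans i3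
      have f4 := (hf 4 (by decide)).trans i4
      have f5 := (hf 5 (by decide)).trans i5
      have f17 := (hf 17 (by decide)).trans i17
      have f20 := (hf 20 (by decide)).trans i20
      have f21 := (hf 21 (by decide)).trans i21
      have f22 := (hf 22 (by decide)).trans i22
      have f25 := (hf 25 (by decide)).trans i25
      obtain ⟨τ₁, r₁, d12, hm₁⟩ := runs_simulateProg (q := 4096 * l) (l := l) (s := s) (by omega)
        (by omega) f1 f2 f3 f4 f5 f20 f21 f22 f25
        (fun i => (hm _ (by have := i.isLt; omega)).trans (hs i))
      rw [scoreAfter_congr (g' := fun x => v / (4 * N) ^ x % (4 * N)) s hd] at d12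
      have e0 := r₁.reg_eq 0 (by decide)
      have e17 := (r₁.reg_eq 17 (by decide)).trans f17
      have r₂ := Runs.block [.sub 14 17 12, .add 0 0 14] τ₁
      set τ₂ := runAll [.sub 14 17 12, .add 0 0 14] τ₁ with hτ₂
      have m₂ : τ₂.mem = τ₁.mem := by simp [hτ₂, runAll, Op.run]
      have f₂ (x : ℕ) (hx : x ∉ simulateProg.writes) (hx' : x ≠ 14 ∧ x ≠ 0) :
          τ₂.reg x = τ.reg x := by
        rw [← r₁.reg_eq x hx]
        simp [hτ₂, runAll, Op.run, hx']
      obtain ⟨τ₃, r₃, g18, hd₃, hm₃⟩ := runs_incrProg (K := K) (D := D) hN hv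
        ((f₂ 1 (by decide) (by decide)).trans f1) ((f₂ 3 (by decide) (by decide)).trans f3)
        ((f₂ 4 (by decide) (by decide)).trans f4) ((f₂ 20 (by decide) (by decide)).trans f20)
        ((f₂ 25 (by decide) (by decide)).trans f25)
        (fun x hx => by rw [m₂, hm₁ _ (by omega) (by omega), hd x hx])
      refine ⟨τ₃, (r₁.seq (r₂.seq r₃)).mono (by simp; omega), ?_, g18, hd₃, fun x hx => ?_⟩
      · have h : τ₃.reg 0 = τ.reg 0 + (b - τ₁.reg 12) := by
          rw [r₃.reg_eq 0 (by decide)]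
          simp [hτ₂, runAll, Op.run, e0, e17]
        rw [h, d12]
        have : b - rank (scoreAfter (4096 * l) (fun x => v / (4 * N) ^ x % (4 * N)) s l)
            ⟨0, hN⟩ ≠ 0 ↔ succeeds v := by
          rw [Nat.sub_ne_zero_iff_lt]
        rw [ne_eq, Nat.add_eq_zero_iff, not_and_or, ← ne_eq, ← ne_eq, c0, this]
        constructor
        · rintro (⟨u, hu, h⟩ | h)
          · exact ⟨u, by omega, h⟩
          · exact ⟨v, by omega, h⟩
        · rintro ⟨u, hu, h⟩
          rcases Nat.lt_succ_iff_lt_or_eq.1 hu with hu | rfl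
          · exact Or.inl ⟨u, hu, h⟩
          · exact Or.inr h
      · rw [hm₃ _ (by omega), m₂, hm₁ _ (by omega) (Or.inl hx), hm x hx])
  have hiff : CanBreak ⟨0, hN⟩ b l s ↔ ∃ u < (4 * N) ^ K, succeeds u := by
    rw [canBreak_iff (q := 4096 * l) (fun i => Nat.zero_le _) (Dvd.intro _ rfl) le_rfl]
    constructor
    · rintro ⟨g, hg, h⟩
      obtain ⟨v, hv, hvg⟩ := exists_digits (K := K) hg
      refine ⟨v, hv, ?_⟩
      simp only [succeeds]
      rw [scoreAfter_congr (g' := g) s hvg, rank_eq_card]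
      exact h
    · rintro ⟨v, -, h⟩
      simp only [succeeds] at h
      rw [rank_eq_card] at h
      exact ⟨_, fun x => Nat.mod_lt _ hN, h⟩
  have j20 := (hrun₂.reg_eq 20 (by decide)).trans i20
  refine ⟨_, (hrun₁.seq (hrun₂.seq (Runs.block _ _))).mono ?_, fun h => ?_, fun h => ?_⟩
  · simp only [List.length_cons, List.length_nil, breakTime, ← hK]
    ring_nf
    omega
  · rw [hiff, ← a0] at h
    simp [runAll, Op.run, j20]
    omega
  · rw [hiff, ← a0, not_not] at h
    simp [runAll, Op.run, j20, h]

/-! ### The running time of the program -/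

/-- With `M = n ^ k`, there are at most `n ^ (12288 * k ^ 2)` codes, and each takes at most `M ^ 13`
steps. -/
theorem breakTime_le {N l k : ℕ} (hN : 0 < N) (hk : 1 ≤ k) (hl : l ≤ k) :
    breakTime N l ≤ (4 * N) ^ (12310 * k ^ 4) := by
  set M := (4 * N) ^ k with hM
  have hM₁ : 4 * N ≤ M := Nat.le_self_pow (by omega) _
  have hM₄ : 4 ≤ M := by omega
  have hlM : l ≤ M := hl.trans ((Nat.lt_pow_self (by omega)).le)
  have p₁ : 1 ≤ M ^ 3 := Nat.one_le_pow _ _ (by omega)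
  have p₂ : M ≤ M ^ 3 := Nat.le_self_pow (by norm_num) _
  have p₃ : M ^ 2 ≤ M ^ 3 := Nat.pow_le_pow_right (by omega) (by norm_num)
  have p₄ : 4 ^ 10 ≤ M ^ 10 := Nat.pow_le_pow_left hM₄ 10
  have hsim : simulateTime N (4096 * l) l ≤
      M * (11 * M + 4096 * M * (24 * M + 29) + M * (52 * M + 14) + 14) + 52 * M + 12 := by
    have hNM : N ≤ M := by omega
    unfold simulateTime
    gcongr
  have hK : 3 * (4096 * l) * l ≤ 12288 * M ^ 2 := by
    calc 3 * (4096 * l) * l = 12288 * (l * l) := by ring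
      _ ≤ 12288 * (M * M) := by gcongr
      _ = 12288 * M ^ 2 := by ring
  have hbody : simulateTime N (4096 * l) l + 9 * (3 * (4096 * l) * l) + 8 + (3 * l + 30) ≤
      M ^ 13 := by
    calc simulateTime N (4096 * l) l + 9 * (3 * (4096 * l) * l) + 8 + (3 * l + 30)
        ≤ 4 ^ 10 * M ^ 3 := by nlinarith
      _ ≤ M ^ 10 * M ^ 3 := by gcongr
      _ = M ^ 13 := by ring
  have hpow : 1 ≤ (4 * N) ^ (3 * (4096 * l) * l) := Nat.one_le_pow _ _ (by omega)
  have hexp : 3 * (4096 * l) * l + k * 13 ≤ 12310 * k ^ 4 := by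
    have h₁ : l * l ≤ k ^ 4 := by
      calc l * l ≤ k * k := by gcongr
        _ = k ^ 2 := by ring
        _ ≤ k ^ 4 := Nat.pow_le_pow_right hk (by norm_num)
    have h₂ : k ≤ k ^ 4 := Nat.le_self_pow (by norm_num) _
    nlinarith
  calc breakTime N l
      ≤ (4 * N) ^ (3 * (4096 * l) * l) *
        (simulateTime N (4096 * l) l + 9 * (3 * (4096 * l) * l) + 8 + (3 * l + 30)) := by
        unfold breakTime
        rw [mul_add _ _ (3 * l + 30), add_assoc]
        gcongr
        exact Nat.le_mul_of_pos_left _ hpow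
    _ ≤ (4 * N) ^ (3 * (4096 * l) * l) * M ^ 13 := by gcongr
    _ = (4 * N) ^ (3 * (4096 * l) * l + k * 13) := by rw [hM, ← pow_mul, pow_add]
    _ ≤ (4 * N) ^ (12310 * k ^ 4) := Nat.pow_le_pow_right (by omega) hexp

theorem answers_breakProg {k : ℕ} (hk : 1 ≤ k) (x : Tournament) (hx : x.rounds ≤ k) :
    Answers unitCost breakProg x.encode x.IsYes (x.teams ^ (12310 * k ^ 4)) := by
  obtain ⟨n, hn, ⟨N, rfl⟩, s, l, b⟩ := x
  obtain ⟨τ, ⟨t, ht, hP⟩, hyes, hno⟩ := runs_breakProg hn (s := s) (l := l) (b := b)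
    (σ := start (Tournament.encode ⟨4 * N, hn, ⟨N, rfl⟩, s, l, b⟩))
    (by simp [start, Tournament.encode]) (by simp [start, Tournament.encode])
    (by simp [start, Tournament.encode])
    (fun i => by simp [start, Tournament.encode, add_comm 2, List.getD])
    (fun x hx => by
      simp only [start]
      rw [List.getD_eq_default]
      simp [Tournament.encode]
      omega)
  exact ⟨t, τ, hP, ht.trans (breakTime_le (by omega) hk hx), hyes, hno⟩

end Debating

theorem theorem4 :
    (∃ (P : RAM.Program) (C : ℕ), ∀ (k : ℕ) (x : Debating.Tournament), 1 ≤ k → x.rounds ≤ k →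
      RAM.Answers RAM.unitCost P x.encode x.IsYes (x.teams ^ (C * k ^ 4))) ∧
    ∀ k : ℕ, RAM.InP (fun x : {x : Debating.Tournament // x.rounds ≤ k} => x.1.encode)
      (fun x => x.1.IsYes) := by
  refine ⟨⟨Debating.breakProg, 12310, fun k x hk hx => Debating.answers_breakProg hk x hx⟩,
    fun k => RAM.inP_of_unitCost (P := Debating.breakProg) (e := 12310 * (k + 1) ^ 4) fun x => ?_⟩
  obtain ⟨t, τ, hP, ht, hA⟩ :=
    Debating.answers_breakProg (k := k + 1) (by omega) x.1 (by have := x.2; omega)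
  refine ⟨t, τ, hP, ht.trans (Nat.pow_le_pow_left ?_ _), hA⟩
  simp only [Debating.Tournament.encode, List.length_cons, List.length_ofFn]
  omega
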